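/- **Setting.** Let $\Delta>0$, $p\ge 1$, $\mathcal N=\{1,\dots,p\}$, $n=\sum_i n_i$. $\mathcal{PC}([-\Delta,0],\mathbb R^d)$ denotes the (right-continuous) piecewise continuous functions, with $\|\phi\|=\sup_{\theta}|\phi(\theta)|$; continuity and local Lipschitz continuity of functionals refer to this norm. For $\phi\in\mathcal{PC}([-\Delta,0],\mathbb R^n)$ write $\phi=(\phi_1,\dots,\phi_p)$ with $\phi_i\in\mathcal{PC}([-\Delta,0],\mathbb R^{n_i})$, and $x_t(\theta)=x(t+\theta)$. Consider the interconnected system $\mathcal S$ $$\dot x_i=f_i(x_t)+g_i(x_t)u_i,\quad t\ge 0,\qquad x_i=\xi_i\ \text{on }[-\Delta,0],\qquad i\in\mathcal N,$$ with $x_i\in\mathbb R^{n_i}$, $u_i\in\mathbb R^{m_i}$ and locally Lipschitz $f_i:\mathcal{PC}([-\Delta,0],\mathbb R^n)\to\mathbb R^{n_i}$, $g_i:\mathcal{PC}([-\Delta,0],\mathbb R^n)\to\mathbb R^{n_i\times m_i}$ such that $f_i(0)=0$, $g_i(0)=0$. Derivatives are right derivatives. A trajectory is piecewise continuous on $[-\Delta,0]$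 and continuous for $t\ge0$. A functional $V_i(\phi_i)=V_{i1}(\phi_i(0))+V_{i2}(\phi_i)$ is *continuously i-differentiable* if $V_{i1}\ge0$ is $C^1$ with $\alpha(|y|)\le V_{i1}(y)\le\alpha'(|y|)$ for some $\alpha,\alpha'\in\mathcal K_\infty$; $V_{i2}\ge0$ is locally Lipschitz and $t\mapsto V_{i2}(x_t)$ is continuous on $[0,\infty)$ along every trajectory; the upper right Dini derivative $D^+V_{i2}(\phi_i)$ of $t\mapsto V_{i2}(x_t)$ at $t=0$ is finite, the same for all trajectories $x$ with $x_0=\phi_i$, and continuous in $\phi_i$; and, for every trajectory $x$ and $t\ge0$, with $z=x(t+l)-x(t)$, $$V_i(x_{t+l})-V_i(x_t)=\partial V_{i1}(x(t))z+D^+V_{i2}(x_t)\,l+o\big(\sqrt{|z|^2+l^2}\big),\quad l\to0^+.$$ Put $L_{f_i}V_{i1}(\phi)=\partial V_{i1}(\phi_i(0))f_i(\phi)$ and $L_{g_i}V_{i1}(\phi)=\partial V_{i1}(\phi_i(0))g_i(\phi)$. **MCLFs.** Continuously i-differentiable $V_1,\dots,V_p$ are *multiple control Lyapunov functionals* with gains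 $\rho_i\in\mathcal K$ and $\gamma_{ij}\in\mathcal K$ ($j\ne i$) if (i) there are $\alpha_{i1},\alpha_{i2}\in\mathcal K_\infty$ with $\alpha_{i1}(|\phi_i(0)|)\le V_i(\phi_i)\le\alpha_{i2}(\|\phi_i\|)$ for all $\phi_i$; (ii) for all $i$ and all $\phi\ne0$, $$\inf_{u_i\in\mathbb R^{m_i}}\{L_{f_i}V_{i1}(\phi)+D^+V_{i2}(\phi_i)+L_{g_i}V_{i1}(\phi)u_i\}<-\rho_i(V_i(\phi_i))+\sum_{j\ne i}\gamma_{ij}(V_j(\phi_j));$$ (iii) there are bounded (continuous) positive definite functions $\zeta_i:\mathbb R\to\mathbb R_+$ with $\int_0^\infty\zeta_i(\rho_i(s))\,ds=\infty$ such that, with $A(r)=(\rho_i(r_i))_i$ and $\Gamma(r)=(\sum_{j\ne i}\gamma_{ij}(r_j))_i$ on $\mathbb R_+^p$ and $\zeta(s)=(\zeta_i(s_i))_i$, one has $\zeta(s)^\top\Gamma(A^{-1}(s))<\zeta(s)^\top s$ for every nonzero $s$ in the range of $A$. **DSCP.** The *distributed small control property* holds if for all $\varepsilon_i>0$ ($i\in\mathcal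 N$) there are $\delta_i>0$ such that, whenever $|\phi_j(\theta)|<\delta_j$ for all $j$ and $\theta$, for each $i$ with $\phi_i\neq0$ there is $u_i$ with $|u_i|<\varepsilon_i$ and $L_{f_i}V_{i1}(\phi)+D^+V_{i2}(\phi_i)+L_{g_i}V_{i1}(\phi)u_i<-\rho_i(V_i(\phi_i))+\sum_{j\ne i}\gamma_{ij}(V_j(\phi_j))$. **Theorem.** Suppose $\mathcal S$ admits MCLFs $V_i$ with gains $\rho_i,\gamma_{ij}$ and satisfies the DSCP. Let $\mathfrak a_i(\phi)=L_{f_i}V_{i1}(\phi)+D^+V_{i2}(\phi_i)+\rho_i(V_i(\phi_i))-\sum_{j\ne i}\gamma_{ij}(V_j(\phi_j))$, $\mathfrak b_i(\phi)=L_{g_i}V_{i1}(\phi)$, and $$u_i(\phi)=\begin{cases}-\dfrac{\mathfrak a_i(\phi)+\sqrt{\mathfrak a_i(\phi)^2+\|\mathfrak b_i(\phi)\|^4}}{\|\mathfrak b_i(\phi)\|^2}\,\mathfrak b_i(\phi)^\top,&\phi\ne0\text{ and }\mathfrak b_i(\phi)\neq0,\\0,&\text{otherwise.}\end{cases}$$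 Then every $u_i:\mathcal{PC}([-\Delta,0],\mathbb R^n)\to\mathbb R^{m_i}$ is continuous (including at $\phi=0$), and the closed-loop system is globally asymptotically stable: there is $\beta\in\mathcal{KL}$ such that for every initial function $\xi\in\mathcal{PC}([-\Delta,0],\mathbb R^n)$, every $T\in(0,\infty]$ and every solution $x$ of the closed loop on $[-\Delta,T)$ with $x_0=\xi$, $|x(t)|\le\beta(\|\xi\|,t)$ for all $t\in[0,T)$. -/

import Mathlib

open Set Filter Topology
open scoped NNReal ENNReal

noncomputable section

/-! ### Piecewise continuous histories and the sup norm -/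

/-- The interval `[-Δ, 0]`. -/
abbrev DelayInterval (Δ : ℝ≥0) : Type := Icc (-(Δ : ℝ)) 0

/-- The right end point `0` of `[-Δ, 0]`. -/
def DelayInterval.zero (Δ : ℝ≥0) : DelayInterval Δ := ⟨0, by simp⟩

/-- Piecewise continuity on `[-Δ, 0]`, in the usual right-continuous convention: finitely many
discontinuities, right-continuous, with left limits. (At the two end points the one-sided
condition pointing out of the interval is void.) -/
structure IsPC {Δ : ℝ≥0} {E : Type*} [TopologicalSpace E] (φ : DelayInterval Δ → E) : Prop where
  finite_disc : {θ | ¬ ContinuousAt φ θ}.Finite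
  right_cont : ∀ θ, ContinuousWithinAt φ (Ici θ) θ
  left_lim : ∀ θ, ∃ l, Tendsto φ (𝓝[<] θ) (𝓝 l)

/-- A piecewise continuous function on `[-Δ, 0]` is bounded. -/
theorem IsPC.memℓp {Δ : ℝ≥0} {E : Type*} [NormedAddCommGroup E] {φ : DelayInterval Δ → E}
    (h : IsPC φ) : Memℓp (E := fun _ : DelayInterval Δ => E) φ ∞ := by
  apply memℓp_infty
  have key : ∃ C : ℝ, ∀ θ ∈ (univ : Set (DelayInterval Δ)), ‖φ θ‖ ≤ C := by
    refine isCompact_univ.induction_on (p := fun s => ∃ C : ℝ, ∀ θ ∈ s, ‖φ θ‖ ≤ C) ⟨0, by simp⟩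
      ?_ ?_ ?_
    · rintro s t hst ⟨C, hC⟩
      exact ⟨C, fun θ hθ => hC θ (hst hθ)⟩
    · rintro s t ⟨C, hC⟩ ⟨D, hD⟩
      refine ⟨max C D, ?_⟩
      rintro θ (hθ | hθ)
      · exact (hC θ hθ).trans (le_max_left _ _)
      · exact (hD θ hθ).trans (le_max_right _ _)
    · intro θ _
      obtain ⟨l, hl⟩ := h.left_lim θ
      have h1 : ∀ᶠ τ in 𝓝[<] θ, ‖φ τ‖ ≤ ‖l‖ + 1 :=
        (hl.norm.eventually (gt_mem_nhds (lt_add_one _))).mono fun _ hx => hx.le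
      have h2 : ∀ᶠ τ in 𝓝[≥] θ, ‖φ τ‖ ≤ ‖φ θ‖ + 1 :=
        ((h.right_cont θ).norm.eventually (gt_mem_nhds (lt_add_one _))).mono fun _ hx => hx.le
      have h3 : ∀ᶠ τ in 𝓝 θ, ‖φ τ‖ ≤ max (‖l‖ + 1) (‖φ θ‖ + 1) := by
        rw [← nhdsLT_sup_nhdsGE, eventually_sup]
        exact ⟨h1.mono fun _ hx => hx.trans (le_max_left _ _),
          h2.mono fun _ hx => hx.trans (le_max_right _ _)⟩
      exact ⟨_, mem_nhdsWithin_of_mem_nhds h3, _, fun _ hx => hx⟩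
  obtain ⟨C, hC⟩ := key
  exact ⟨C, by rintro _ ⟨θ, rfl⟩; exact hC θ (mem_univ _)⟩

/-- The piecewise continuous functions on `[-Δ, 0]`, as a linear subspace of the space of bounded
functions with the sup norm. -/
def pcSubmodule (Δ : ℝ≥0) (E : Type*) [NormedAddCommGroup E] [NormedSpace ℝ E] :
    Submodule ℝ (lp (fun _ : DelayInterval Δ => E) ∞) where
  carrier := {φ | IsPC (fun θ => φ θ)}
  zero_mem' := by
    refine ⟨?_, fun θ => ?_, fun θ => ⟨0, ?_⟩⟩
    · simp [continuousAt_const]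
    · simpa using continuousWithinAt_const
    · simpa using tendsto_const_nhds
  add_mem' := by
    intro φ ψ hφ hψ
    refine ⟨(hφ.finite_disc.union hψ.finite_disc).subset ?_, fun θ => ?_, fun θ => ?_⟩
    · intro θ hθ
      by_contra hc
      simp only [mem_union, mem_ofPred_eq, not_or, not_not] at hc
      exact hθ (hc.1.add hc.2)
    · exact (hφ.right_cont θ).add (hψ.right_cont θ)
    · obtain ⟨l, hl⟩ := hφ.left_lim θ
      obtain ⟨k, hk⟩ := hψ.left_lim θ
      exact ⟨l + k, hl.add hk⟩
  smul_mem' := by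
    intro c φ hφ
    refine ⟨hφ.finite_disc.subset ?_, fun θ => ?_, fun θ => ?_⟩
    · intro θ hθ hc
      exact hθ (ContinuousAt.const_smul hc c)
    · exact (hφ.right_cont θ).const_smul c
    · obtain ⟨l, hl⟩ := hφ.left_lim θ
      exact ⟨c • l, hl.const_smul c⟩

/-- The space `PC([-Δ, 0], E)` with the norm `‖φ‖ = sup_θ ‖φ(θ)‖`. -/
abbrev Hist (Δ : ℝ≥0) (E : Type*) [NormedAddCommGroup E] [NormedSpace ℝ E] : Type _ :=
  pcSubmodule Δ E

namespace Hist

variable {Δ : ℝ≥0} {E : Type*} [NormedAddCommGroup E] [NormedSpace ℝ E]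

/-- The value `φ(θ)` of a history. -/
def eval (φ : Hist Δ E) (θ : DelayInterval Δ) : E := φ.1 θ

/-- The current value `φ(0)` of a history. -/
def now (φ : Hist Δ E) : E := φ.eval (DelayInterval.zero Δ)

/-- A piecewise continuous function as an element of the space of histories. -/
def mk (φ : DelayInterval Δ → E) (h : IsPC φ) : Hist Δ E := ⟨⟨φ, h.memℓp⟩, h⟩

theorem eval_mk (φ : DelayInterval Δ → E) (h : IsPC φ) (θ : DelayInterval Δ) :
    (mk φ h).eval θ = φ θ := rfl

theorem isPC (φ : Hist Δ E) : IsPC φ.eval := φ.2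

theorem norm_eq (φ : Hist Δ E) : ‖φ‖ = ⨆ θ, ‖φ.eval θ‖ := lp.norm_eq_ciSup φ.1

end Hist

/-- The history `x_t`, `x_t(θ) = x(t + θ)` for `θ ∈ [-Δ, 0]` (with value `0` when this function
is not piecewise continuous, which never happens along a trajectory: see `eval_seg`). -/
def seg (Δ : ℝ≥0) {E : Type*} [NormedAddCommGroup E] [NormedSpace ℝ E] (x : ℝ → E) (t : ℝ) :
    Hist Δ E :=
  open Classical in
  if h : IsPC (fun θ : DelayInterval Δ => x (t + θ)) then Hist.mk _ h else 0

/-- The time interval `[0, T)`, where `T = ⊤` is allowed. -/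
def timeInterval (T : EReal) : Set ℝ := {t | 0 ≤ t ∧ (t : EReal) < T}

/-- `x` is a trajectory on `[-Δ, T)`: piecewise continuous on `[-Δ, 0]`, continuous on `[0, T)`. -/
structure IsTrajectory (Δ : ℝ≥0) {E : Type*} [TopologicalSpace E] (x : ℝ → E) (T : EReal) :
    Prop where
  init : IsPC (fun θ : DelayInterval Δ => x θ)
  cont : ContinuousOn x (timeInterval T)

theorem IsTrajectory.isPC {Δ : ℝ≥0} {E : Type*} [TopologicalSpace E] {x : ℝ → E} {T : EReal}
    (hx : IsTrajectory Δ x T) {t : ℝ} (ht : t ∈ timeInterval T) :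
    IsPC (fun θ : DelayInterval Δ => x (t + θ)) := by
  obtain ⟨ht0, htT⟩ := ht
  have hΔ : -(Δ : ℝ) ≤ 0 := by simp
  -- the shift, cut off at the end points
  let m : DelayInterval Δ → DelayInterval Δ := fun θ => projIcc (-(Δ : ℝ)) 0 hΔ (t + θ)
  have hmc : Continuous m := continuous_projIcc.comp (by fun_prop)
  have hmm : Monotone m := fun a b hab =>
    monotone_projIcc hΔ (by simpa using (show (a : ℝ) ≤ b from hab))
  have hmv : ∀ θ : DelayInterval Δ, t + θ ≤ 0 → (m θ : ℝ) = t + θ := by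
    intro θ hθ
    have : t + (θ : ℝ) ∈ Icc (-(Δ : ℝ)) 0 := ⟨by linarith [θ.2.1], hθ⟩
    simp only [m, projIcc_of_mem hΔ this]
  have hJ : ∀ θ : DelayInterval Δ, 0 ≤ t + (θ : ℝ) → t + (θ : ℝ) ∈ timeInterval T := by
    intro θ hθ
    refine ⟨hθ, lt_of_le_of_lt ?_ htT⟩
    exact_mod_cast (by linarith [θ.2.2] : t + (θ : ℝ) ≤ t)
  have hca : ∀ θ : DelayInterval Δ, 0 ≤ t + (θ : ℝ) →
      ContinuousWithinAt (fun θ : DelayInterval Δ => x (t + θ))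
        {τ : DelayInterval Δ | 0 ≤ t + (τ : ℝ)} θ := by
    intro θ hθ
    exact ContinuousWithinAt.comp (t := timeInterval T) (hx.cont _ (hJ θ hθ))
      (by fun_prop) (fun τ hτ => hJ τ hτ)
  have hpos : ∀ θ : DelayInterval Δ, 0 < t + (θ : ℝ) →
      ContinuousAt (fun θ : DelayInterval Δ => x (t + θ)) θ := by
    intro θ hθ
    refine (hca θ hθ.le).continuousAt ?_
    have : Continuous fun τ : DelayInterval Δ => t + (τ : ℝ) := by fun_prop
    exact (this.continuousAt.eventually (lt_mem_nhds hθ)).mono fun _ h => le_of_lt h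
  have heq : ∀ θ : DelayInterval Δ, t + (θ : ℝ) < 0 →
      (fun θ : DelayInterval Δ => x (t + θ)) =ᶠ[𝓝 θ] (fun θ : DelayInterval Δ => x θ) ∘ m := by
    intro θ hθ
    have : Continuous fun τ : DelayInterval Δ => t + (τ : ℝ) := by fun_prop
    refine (this.continuousAt.eventually (gt_mem_nhds hθ)).mono fun τ h => ?_
    simp only [Function.comp, hmv τ (le_of_lt h)]
  refine ⟨?_, ?_, ?_⟩
  · refine ((hx.init.finite_disc.image
      (fun σ : DelayInterval Δ => projIcc (-(Δ : ℝ)) 0 hΔ ((σ : ℝ) - t))).union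
      (finite_singleton (projIcc (-(Δ : ℝ)) 0 hΔ (-t)))).subset ?_
    intro θ hθ
    rcases lt_trichotomy (t + (θ : ℝ)) 0 with h | h | h
    · left
      refine ⟨m θ, fun hc => hθ ?_, ?_⟩
      · exact ((ContinuousAt.comp hc hmc.continuousAt).congr (heq θ h).symm)
      · simp only [hmv θ h.le, add_sub_cancel_left, projIcc_val]
    · right
      have : -t = (θ : ℝ) := by linarith
      simp only [this, projIcc_val, mem_singleton_iff]
    · exact absurd (hpos θ h) hθ
  · intro θ
    rcases lt_or_ge (t + (θ : ℝ)) 0 with h | h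
    · have h1 : ContinuousWithinAt ((fun θ : DelayInterval Δ => x θ) ∘ m) (Ici θ) θ :=
        (hx.init.right_cont (m θ)).comp hmc.continuousWithinAt (fun τ hτ => hmm hτ)
      exact h1.congr_of_eventuallyEq ((heq θ h).filter_mono nhdsWithin_le_nhds) (heq θ h).eq_of_nhds
    · refine (hca θ h).mono fun τ hτ => ?_
      have : (θ : ℝ) ≤ τ := hτ
      simp only [mem_ofPred_eq]
      linarith
  · intro θ
    rcases lt_or_ge 0 (t + (θ : ℝ)) with h | h
    · exact ⟨_, (hpos θ h).tendsto.mono_left nhdsWithin_le_nhds⟩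
    · obtain ⟨l, hl⟩ := hx.init.left_lim (m θ)
      refine ⟨l, ?_⟩
      have hlt : ∀ τ ∈ Iio θ, t + (τ : ℝ) < t + (θ : ℝ) := fun τ hτ => by
        have : (τ : ℝ) < θ := hτ
        linarith
      have hm : Tendsto m (𝓝[<] θ) (𝓝[<] (m θ)) := by
        refine tendsto_nhdsWithin_of_tendsto_nhds_of_eventually_within _
          (hmc.continuousAt.tendsto.mono_left nhdsWithin_le_nhds) ?_
        refine eventually_nhdsWithin_of_forall fun τ hτ => ?_
        have h1 := hlt τ hτ
        show (m τ : ℝ) < m θ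
        rw [hmv τ (by linarith), hmv θ h]
        exact h1
      refine (hl.comp hm).congr' ?_
      refine eventually_nhdsWithin_of_forall fun τ hτ => ?_
      have h1 := hlt τ hτ
      simp only [Function.comp, hmv τ (by linarith)]

theorem eval_seg {Δ : ℝ≥0} {E : Type*} [NormedAddCommGroup E] [NormedSpace ℝ E] {x : ℝ → E}
    {T : EReal} (hx : IsTrajectory Δ x T) {t : ℝ} (ht : t ∈ timeInterval T)
    (θ : DelayInterval Δ) : (seg Δ x t).eval θ = x (t + θ) := by
  rw [seg, dif_pos (hx.isPC ht), Hist.eval_mk]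

/-! ### Comparison functions -/

/-- Class `𝒦` (functions on `[0, ∞)`; values at negative arguments are irrelevant). -/
structure IsClassK (α : ℝ → ℝ) : Prop where
  cont : ContinuousOn α (Ici 0)
  strictMono : StrictMonoOn α (Ici 0)
  zero : α 0 = 0

/-- Class `𝒦_∞`. -/
structure IsClassKInfty (α : ℝ → ℝ) : Prop extends IsClassK α where
  unbounded : Tendsto α atTop atTop

/-- Class `𝒦ℒ`. -/
structure IsClassKL (β : ℝ → ℝ → ℝ) : Prop where
  cont : ContinuousOn (fun q : ℝ × ℝ => β q.1 q.2) (Ici 0 ×ˢ Ici 0)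
  classK : ∀ t, 0 ≤ t → IsClassK (fun s => β s t)
  antitone : ∀ s, 0 ≤ s → AntitoneOn (β s) (Ici 0)
  tendsto : ∀ s, 0 ≤ s → Tendsto (β s) atTop (𝓝 0)

/-- Bounded positive definite functions. -/
structure IsBoundedPosDef (ζ : ℝ → ℝ) : Prop where
  cont : Continuous ζ
  zero : ζ 0 = 0
  pos : ∀ s, s ≠ 0 → 0 < ζ s
  bounded : ∃ M, ∀ s, ζ s ≤ M

/-! ### Dini derivatives and invariantly differentiable functionals -/

section Functionals

variable {Δ : ℝ≥0} {E : Type*} [NormedAddCommGroup E] [NormedSpace ℝ E]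

/-- The upper right Dini derivative of `t ↦ h(x_t)` at time `t`, as an extended real. -/
def upperDini (h : Hist Δ E → ℝ) (x : ℝ → E) (t : ℝ) : EReal :=
  limsup (fun s : ℝ => (((h (seg Δ x (t + s)) - h (seg Δ x t)) / s : ℝ) : EReal)) (𝓝[>] 0)

/-- The continuation of the history `φ` by the constant value `φ(0)`. -/
def freeze (φ : Hist Δ E) (t : ℝ) : E :=
  open Classical in
  if h : t ∈ Icc (-(Δ : ℝ)) 0 then φ.eval ⟨t, h⟩ else φ.now

/-- The value `D⁺h(φ)`, computed along the constant continuation of `φ`. It is only used for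
functionals whose Dini derivative is finite and the same along all continuations. -/
def diniAt (h : Hist Δ E → ℝ) (φ : Hist Δ E) : ℝ := (upperDini h (freeze φ) 0).toReal

/-- A functional given in the separated form `V(φ) = V₁(φ(0)) + V₂(φ)`. -/
structure SplitFunctional (Δ : ℝ≥0) (E : Type*) [NormedAddCommGroup E] [NormedSpace ℝ E] where
  V₁ : E → ℝ
  V₂ : Hist Δ E → ℝ

namespace SplitFunctional

/-- The value `V(φ) = V₁(φ(0)) + V₂(φ)`. -/
def val (V : SplitFunctional Δ E) (φ : Hist Δ E) : ℝ := V.V₁ φ.now + V.V₂ φ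

/-- Smoothly separable functionals. -/
structure IsSmoothlySeparable (V : SplitFunctional Δ E) : Prop where
  contDiff : ContDiff ℝ 1 V.V₁
  nonneg₁ : ∀ y, 0 ≤ V.V₁ y
  nonneg₂ : ∀ φ, 0 ≤ V.V₂ φ
  locallyLipschitz : LocallyLipschitz V.V₂
  bounds : ∃ α₁ α₂ : ℝ → ℝ, IsClassKInfty α₁ ∧ IsClassKInfty α₂ ∧
    ∀ y, α₁ ‖y‖ ≤ V.V₁ y ∧ V.V₁ y ≤ α₂ ‖y‖

/-- Continuously invariantly differentiable functionals. Along a trajectory the Dini derivative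
is taken of a continuous function of time (`cont_along`; for a continuous history this is
automatic); it is finite and independent of how the history is continued (`invariant`). -/
structure IsContIDifferentiable (V : SplitFunctional Δ E) : Prop extends
    IsSmoothlySeparable V where
  cont_along : ∀ x : ℝ → E, IsTrajectory Δ x ⊤ →
    ContinuousOn (fun t => V.V₂ (seg Δ x t)) (Ici 0)
  invariant : ∀ x : ℝ → E, IsTrajectory Δ x ⊤ →
    upperDini V.V₂ x 0 = (diniAt V.V₂ (seg Δ x 0) : EReal)
  expansion : ∀ x : ℝ → E, IsTrajectory Δ x ⊤ → ∀ t, 0 ≤ t →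
    (fun l : ℝ => V.val (seg Δ x (t + l)) - V.val (seg Δ x t)
        - (fderiv ℝ V.V₁ (x t) (x (t + l) - x t) + diniAt V.V₂ (seg Δ x t) * l))
      =o[𝓝[>] 0] fun l : ℝ => √(‖x (t + l) - x t‖ ^ 2 + l ^ 2)
  cont_dini : Continuous (diniAt V.V₂)

end SplitFunctional

end Functionals

/-! ### Interconnected time-delay systems -/

section Systems

variable {p : ℕ}

/-- The augmented state space `ℝⁿ = ℝ^{n₁} × ⋯ × ℝ^{n_p}` with the Euclidean norm. -/
abbrev AugState (n : Fin p → ℕ) : Type := PiLp 2 fun i : Fin p => EuclideanSpace ℝ (Fin (n i))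

/-- The history `φ_i` of the `i`-th subsystem in the augmented history `φ`. -/
def Hist.comp {Δ : ℝ≥0} {n : Fin p → ℕ} (φ : Hist Δ (AugState n)) (i : Fin p) :
    Hist Δ (EuclideanSpace ℝ (Fin (n i))) :=
  Hist.mk (fun θ => φ.eval θ i) <| by
    have hc : Continuous fun y : AugState n => y i := by fun_prop
    refine ⟨φ.isPC.finite_disc.subset fun θ hθ hφ => hθ ?_, fun θ => ?_, fun θ => ?_⟩
    · exact ContinuousAt.comp (f := φ.eval) hc.continuousAt hφ
    · exact hc.continuousAt.comp_continuousWithinAt (φ.isPC.right_cont θ)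
    · obtain ⟨l, hl⟩ := φ.isPC.left_lim θ
      exact ⟨l i, (hc.tendsto l).comp hl⟩

/-- An interconnected control-affine system with `p` subsystems
`ẋ_i = f_i(x_t) + g_i(x_t) u_i`. The matrices `g_i(φ)` are given as linear maps. -/
structure DelaySystem (Δ : ℝ≥0) (n m : Fin p → ℕ) where
  f : ∀ i, Hist Δ (AugState n) → EuclideanSpace ℝ (Fin (n i))
  g : ∀ i, Hist Δ (AugState n) →
    (EuclideanSpace ℝ (Fin (m i)) →L[ℝ] EuclideanSpace ℝ (Fin (n i)))
  lipschitz_f : ∀ i, LocallyLipschitz (f i)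
  lipschitz_g : ∀ i, LocallyLipschitz (g i)
  f_zero : ∀ i, f i 0 = 0
  g_zero : ∀ i, g i 0 = 0

/-- A family of feedback laws `u_i(φ)`. -/
abbrev Feedback (Δ : ℝ≥0) (n m : Fin p → ℕ) : Type :=
  ∀ i, Hist Δ (AugState n) → EuclideanSpace ℝ (Fin (m i))

namespace DelaySystem

variable {Δ : ℝ≥0} {n m : Fin p → ℕ}

/-- `x` is a solution on `[-Δ, T)` of the closed loop under the feedback `u` with initial history
`ξ`; the derivative is the right derivative, for all `t ∈ [0, T)`. -/
structure IsSolution (S : DelaySystem Δ n m) (u : Feedback Δ n m) (ξ : Hist Δ (AugState n))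
    (T : EReal) (x : ℝ → AugState n) : Prop where
  traj : IsTrajectory Δ x T
  init : ∀ θ : DelayInterval Δ, x θ = ξ.eval θ
  ode : ∀ i, ∀ t ∈ timeInterval T, HasDerivWithinAt (fun τ => x τ i)
    (S.f i (seg Δ x t) + S.g i (seg Δ x t) (u i (seg Δ x t))) (Ici t) t

/-- Global asymptotic stability of the closed loop: one `𝒦ℒ` bound holds for all initial
histories and all solutions, on their whole interval of existence. -/
def IsGAS (S : DelaySystem Δ n m) (u : Feedback Δ n m) : Prop :=
  ∃ β : ℝ → ℝ → ℝ, IsClassKL β ∧ ∀ (ξ : Hist Δ (AugState n)) (T : EReal) (x : ℝ → AugState n),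
    S.IsSolution u ξ T x → ∀ t ∈ timeInterval T, ‖x t‖ ≤ β ‖ξ‖ t

/-- `L_{f_i} V_{i1}(φ)`. -/
def lieF (S : DelaySystem Δ n m) (V : ∀ i, SplitFunctional Δ (EuclideanSpace ℝ (Fin (n i))))
    (i : Fin p) (φ : Hist Δ (AugState n)) : ℝ :=
  fderiv ℝ (V i).V₁ (φ.comp i).now (S.f i φ)

/-- The row vector `𝔟_i(φ) = L_{g_i} V_{i1}(φ)`, as a linear form in `u_i`. -/
def lieG (S : DelaySystem Δ n m) (V : ∀ i, SplitFunctional Δ (EuclideanSpace ℝ (Fin (n i))))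
    (i : Fin p) (φ : Hist Δ (AugState n)) : EuclideanSpace ℝ (Fin (m i)) →L[ℝ] ℝ :=
  (fderiv ℝ (V i).V₁ (φ.comp i).now).comp (S.g i φ)

/-- `L_{f_i} V_{i1}(φ) + D⁺V_{i2}(φ_i) + L_{g_i} V_{i1}(φ) u_i`. -/
def rate (S : DelaySystem Δ n m) (V : ∀ i, SplitFunctional Δ (EuclideanSpace ℝ (Fin (n i))))
    (i : Fin p) (φ : Hist Δ (AugState n)) (w : EuclideanSpace ℝ (Fin (m i))) : ℝ :=
  S.lieF V i φ + diniAt (V i).V₂ (φ.comp i) + S.lieG V i φ w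

end DelaySystem

/-- `-ρ_i(V_i(φ_i)) + ∑_{j ≠ i} γ_{ij}(V_j(φ_j))`. -/
def supplyRate {Δ : ℝ≥0} {n : Fin p → ℕ}
    (V : ∀ i, SplitFunctional Δ (EuclideanSpace ℝ (Fin (n i))))
    (ρ : Fin p → ℝ → ℝ) (γ : Fin p → Fin p → ℝ → ℝ) (i : Fin p) (φ : Hist Δ (AugState n)) : ℝ :=
  -ρ i ((V i).val (φ.comp i)) + ∑ j ∈ Finset.univ.erase i, γ i j ((V j).val (φ.comp j))

/-- The small-gain-type condition: bounded positive definite `ζ_i` with divergent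
`∫₀^∞ ζ_i(ρ_i(s)) ds` and `ζ(s)ᵀ Γ(A⁻¹(s)) < ζ(s)ᵀ s` for every nonzero `s ≥ 0` in the range of
`A(r) = (ρ_i(r_i))_i`; here `r = A⁻¹(s)` and `Γ(r)_i = ∑_{j ≠ i} γ_{ij}(r_j)`. -/
def SmallGain (ρ : Fin p → ℝ → ℝ) (γ : Fin p → Fin p → ℝ → ℝ) : Prop :=
  ∃ ζ : Fin p → ℝ → ℝ, (∀ i, IsBoundedPosDef (ζ i)) ∧
    (∀ i, ∫⁻ s in Ioi (0 : ℝ), ENNReal.ofReal (ζ i (ρ i s)) = ∞) ∧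
    ∀ s r : Fin p → ℝ, (∀ i, 0 ≤ r i) → (∀ i, ρ i (r i) = s i) → s ≠ 0 →
      ∑ i, ζ i (s i) * ∑ j ∈ Finset.univ.erase i, γ i j (r j) < ∑ i, ζ i (s i) * s i

namespace DelaySystem

variable {Δ : ℝ≥0} {n m : Fin p → ℕ}

/-- Multiple control Lyapunov functionals `V_i`, with gains `ρ_i` and `γ_{ij}` (`j ≠ i`). -/
structure IsMCLF (S : DelaySystem Δ n m)
    (V : ∀ i, SplitFunctional Δ (EuclideanSpace ℝ (Fin (n i))))
    (ρ : Fin p → ℝ → ℝ) (γ : Fin p → Fin p → ℝ → ℝ) : Prop where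
  iDiff : ∀ i, (V i).IsContIDifferentiable
  bounds : ∀ i, ∃ α₁ α₂ : ℝ → ℝ, IsClassKInfty α₁ ∧ IsClassKInfty α₂ ∧
    ∀ φ : Hist Δ (EuclideanSpace ℝ (Fin (n i))), α₁ ‖φ.now‖ ≤ (V i).val φ ∧ (V i).val φ ≤ α₂ ‖φ‖
  classK_ρ : ∀ i, IsClassK (ρ i)
  classK_γ : ∀ i j, j ≠ i → IsClassK (γ i j)
  decrease : ∀ i, ∀ φ : Hist Δ (AugState n), φ ≠ 0 →
    (⨅ w : EuclideanSpace ℝ (Fin (m i)), (S.rate V i φ w : EReal)) <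
      (supplyRate V ρ γ i φ : EReal)
  smallGain : SmallGain ρ γ

/-- The distributed small control property. -/
def HasDSCP (S : DelaySystem Δ n m)
    (V : ∀ i, SplitFunctional Δ (EuclideanSpace ℝ (Fin (n i))))
    (ρ : Fin p → ℝ → ℝ) (γ : Fin p → Fin p → ℝ → ℝ) : Prop :=
  ∀ ε : Fin p → ℝ, (∀ i, 0 < ε i) → ∃ δ : Fin p → ℝ, (∀ i, 0 < δ i) ∧
    ∀ φ : Hist Δ (AugState n), (∀ j θ, (φ.comp j).eval θ ∈ Metric.ball 0 (δ j)) →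
      ∀ i, φ.comp i ≠ 0 → ∃ w ∈ Metric.ball (0 : EuclideanSpace ℝ (Fin (m i))) (ε i),
        S.rate V i φ w < supplyRate V ρ γ i φ

/-- `𝔞_i(φ) = L_{f_i}V_{i1}(φ) + D⁺V_{i2}(φ_i) + ρ_i(V_i(φ_i)) - ∑_{j ≠ i} γ_{ij}(V_j(φ_j))`. -/
def coeffA (S : DelaySystem Δ n m)
    (V : ∀ i, SplitFunctional Δ (EuclideanSpace ℝ (Fin (n i))))
    (ρ : Fin p → ℝ → ℝ) (γ : Fin p → Fin p → ℝ → ℝ) (i : Fin p) (φ : Hist Δ (AugState n)) : ℝ :=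
  S.lieF V i φ + diniAt (V i).V₂ (φ.comp i) + ρ i ((V i).val (φ.comp i))
    - ∑ j ∈ Finset.univ.erase i, γ i j ((V j).val (φ.comp j))

/-- The column vector `𝔟_i(φ)ᵀ`. -/
def coeffB (S : DelaySystem Δ n m)
    (V : ∀ i, SplitFunctional Δ (EuclideanSpace ℝ (Fin (n i))))
    (i : Fin p) (φ : Hist Δ (AugState n)) : EuclideanSpace ℝ (Fin (m i)) :=
  (InnerProductSpace.toDual ℝ (EuclideanSpace ℝ (Fin (m i)))).symm (S.lieG V i φ)

/-- Sontag's formula `κ(a, b) = (a + √(a² + ‖b‖⁴)) / (-‖b‖²) · b`. -/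
def sontag {d : ℕ} (a : ℝ) (b : EuclideanSpace ℝ (Fin d)) : EuclideanSpace ℝ (Fin d) :=
  ((a + √(a ^ 2 + ‖b‖ ^ 4)) / (-‖b‖ ^ 2)) • b

/-- The distributed Sontag-type controller. -/
def controller (S : DelaySystem Δ n m)
    (V : ∀ i, SplitFunctional Δ (EuclideanSpace ℝ (Fin (n i))))
    (ρ : Fin p → ℝ → ℝ) (γ : Fin p → Fin p → ℝ → ℝ) : Feedback Δ n m := fun i φ =>
  open Classical in
  if φ ≠ 0 ∧ S.coeffB V i φ ≠ 0 then sontag (S.coeffA V ρ γ i φ) (S.coeffB V i φ) else 0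

end DelaySystem

end Systems

end

/-! ### Sontag's formula -/

namespace DelaySystem

/-! The excess of the rate of V_i over its supply rate is 𝔞_i + ⟨𝔟_i, u_i⟩ (`rate_eq`). Sontag's
feedback turns it into -√(𝔞_i² + ‖𝔟_i‖⁴) where 𝔟_i ≠ 0 (`inner_sontag`); where 𝔟_i = 0 and φ ≠ 0,
the decrease condition itself says 𝔞_i < 0 (`IsMCLF.coeffA_neg`).

Continuity of the controller rests on `norm_sontag_le`: a one-sided bound 𝔞_i ≤ ε‖𝔟_i‖ already gives
‖u_i‖ ≤ 2ε + ‖𝔟_i‖. With ε = 0 this settles the points φ ≠ 0 with 𝔟_i = 0. Near φ = 0 the small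
control property provides the bound for every ε > 0.

For stability, the numbers v_i(t) = V_i of the i-th history satisfy v_i' ≤ -ρ_i(v_i) + ∑_{j ≠ i}
γ_{ij}(v_j). Let Φ_i' = ζ_i ∘ ρ_i. Then W = ∑ Φ_i(v_i) has W' ≤ -Q(v), and the small-gain condition
says exactly that Q > 0 off the origin. Divergence of ∫ ζ_i(ρ_i) makes W proper, so Q ≥ q(W) for a
scalar q (`exists_continuous_minorant`), and w' ≤ -q(w) integrates to a 𝒦ℒ bound
(`exists_classKL_of_hasDerivWithinAt_right`). The 𝒦_∞ bounds on V_i carry it back to |x| and ‖ξ‖. -/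

theorem sontag_zero_right {d : ℕ} (a : ℝ) : sontag a (0 : EuclideanSpace ℝ (Fin d)) = 0 := by
  simp [sontag]

/-- A very negative a is harmless because the root nearly cancels it in the numerator; only a
positive a can make the quotient large, hence the one-sided hypothesis. -/
theorem norm_sontag_le {d : ℕ} {a ε : ℝ} {b : EuclideanSpace ℝ (Fin d)} (hε : 0 ≤ ε)
    (h : a ≤ ε * ‖b‖) : ‖sontag a b‖ ≤ 2 * ε + ‖b‖ := by
  rcases eq_or_ne b 0 with rfl | hb
  · simpa [sontag_zero_right] using hε
  have hb0 : 0 < ‖b‖ := norm_pos_iff.2 hb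
  have h1 : 0 ≤ a + √(a ^ 2 + ‖b‖ ^ 4) := by
    have : |a| ≤ √(a ^ 2 + ‖b‖ ^ 4) := Real.abs_le_sqrt (by nlinarith [pow_pos hb0 4])
    linarith [neg_abs_le a]
  -- The number 2ε‖b‖ - a dominates |a| for either sign of a, which replaces a case distinction.
  have h2 : √(a ^ 2 + ‖b‖ ^ 4) ≤ (2 * (ε * ‖b‖) - a) + ‖b‖ ^ 2 := by
    have h0 : 0 ≤ ε * ‖b‖ := by positivity
    have hd : 0 ≤ 2 * (ε * ‖b‖) - a := by linarith
    have hd2 : a ^ 2 ≤ (2 * (ε * ‖b‖) - a) ^ 2 := by nlinarith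
    refine Real.sqrt_le_iff.2 ⟨by positivity, ?_⟩
    have := mul_nonneg hd (sq_nonneg ‖b‖)
    nlinarith
  rw [sontag, norm_smul, norm_div, Real.norm_of_nonneg h1, norm_neg, norm_pow, norm_norm,
    div_mul_eq_mul_div, div_le_iff₀ (by positivity)]
  calc (a + √(a ^ 2 + ‖b‖ ^ 4)) * ‖b‖ ≤ (2 * (ε * ‖b‖) + ‖b‖ ^ 2) * ‖b‖ := by
        exact mul_le_mul_of_nonneg_right (by linarith) hb0.le
    _ = (2 * ε + ‖b‖) * ‖b‖ ^ 2 := by ring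

theorem inner_sontag {d : ℕ} (a : ℝ) {b : EuclideanSpace ℝ (Fin d)} (hb : b ≠ 0) :
    a + inner ℝ b (sontag a b) = -√(a ^ 2 + ‖b‖ ^ 4) := by
  have hb0 : ‖b‖ ≠ 0 := norm_ne_zero_iff.2 hb
  rw [sontag, inner_smul_right, real_inner_self_eq_norm_sq]
  field_simp
  ring

/-- At b = 0 the formula is singular, but a < 0 persists nearby, so `norm_sontag_le` with ε = 0
squeezes the value by ‖b‖. -/
theorem continuousAt_sontag {d : ℕ} {q : ℝ × EuclideanSpace ℝ (Fin d)}
    (h : q.2 = 0 → q.1 < 0) :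
    ContinuousAt (fun q : ℝ × EuclideanSpace ℝ (Fin d) => sontag q.1 q.2) q := by
  by_cases hb : q.2 = 0
  · have h0 := h hb
    rw [ContinuousAt, hb, sontag_zero_right]
    refine squeeze_zero_norm' (a := fun q : ℝ × EuclideanSpace ℝ (Fin d) => ‖q.2‖) ?_ ?_
    · have : ∀ᶠ r : ℝ × EuclideanSpace ℝ (Fin d) in 𝓝 q, r.1 < 0 :=
        continuous_fst.continuousAt.eventually (gt_mem_nhds h0)
      filter_upwards [this] with r hr
      simpa using norm_sontag_le (b := r.2) le_rfl (by simpa using hr.le)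
    · have : Tendsto (fun q : ℝ × EuclideanSpace ℝ (Fin d) => ‖q.2‖) (𝓝 q) (𝓝 ‖q.2‖) :=
        (continuous_snd.norm).tendsto q
      simpa [hb] using this
  · have hne : -‖q.2‖ ^ 2 ≠ 0 := by simpa using hb
    unfold sontag
    fun_prop (disch := exact hne)

end DelaySystem

/-! ### Continuity of the coefficients -/

namespace Hist

variable {Δ : ℝ≥0} {E : Type*} [NormedAddCommGroup E] [NormedSpace ℝ E]

theorem norm_eval_le (φ : Hist Δ E) (θ : DelayInterval Δ) : ‖φ.eval θ‖ ≤ ‖φ‖ :=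
  lp.norm_apply_le_norm ENNReal.top_ne_zero φ.1 θ

theorem norm_le_of_forall {φ : Hist Δ E} {C : ℝ} (hC : 0 ≤ C) (h : ∀ θ, ‖φ.eval θ‖ ≤ C) :
    ‖φ‖ ≤ C :=
  lp.norm_le_of_forall_le hC h

theorem zero_now : (0 : Hist Δ E).now = 0 := rfl

theorem ext_eval {φ ψ : Hist Δ E} (h : ∀ θ, φ.eval θ = ψ.eval θ) : φ = ψ :=
  Subtype.ext (lp.ext (funext h))

theorem continuous_now : Continuous (now : Hist Δ E → E) := by
  refine LipschitzWith.continuous (K := 1) (LipschitzWith.of_dist_le_mul fun φ ψ => ?_)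
  rw [dist_eq_norm, dist_eq_norm, NNReal.coe_one, one_mul]
  exact norm_eval_le (φ - ψ) _

section Components

variable {p : ℕ} {n : Fin p → ℕ}

theorem comp_eval (φ : Hist Δ (AugState n)) (i : Fin p) (θ : DelayInterval Δ) :
    (φ.comp i).eval θ = φ.eval θ i := rfl

theorem zero_comp (i : Fin p) : (0 : Hist Δ (AugState n)).comp i = 0 := rfl

theorem norm_comp_le (φ : Hist Δ (AugState n)) (i : Fin p) : ‖φ.comp i‖ ≤ ‖φ‖ :=
  norm_le_of_forall (norm_nonneg _) fun θ =>
    (PiLp.norm_apply_le (φ.eval θ) i).trans (norm_eval_le φ θ)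

theorem continuous_comp (i : Fin p) :
    Continuous fun φ : Hist Δ (AugState n) => φ.comp i := by
  refine LipschitzWith.continuous (K := 1) (LipschitzWith.of_dist_le_mul fun φ ψ => ?_)
  rw [dist_eq_norm, dist_eq_norm, NNReal.coe_one, one_mul]
  exact norm_comp_le (φ - ψ) i

end Components

end Hist

theorem IsClassK.continuous_comp_nonneg {X : Type*} [TopologicalSpace X] {α : ℝ → ℝ}
    (h : IsClassK α) {f : X → ℝ} (hf : Continuous f) (h0 : ∀ x, 0 ≤ f x) :
    Continuous fun x => α (f x) :=
  h.cont.comp_continuous hf h0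

namespace SplitFunctional

variable {Δ : ℝ≥0} {E : Type*} [NormedAddCommGroup E] [NormedSpace ℝ E]
  {V : SplitFunctional Δ E}

theorem IsSmoothlySeparable.val_nonneg (h : V.IsSmoothlySeparable) (φ : Hist Δ E) :
    0 ≤ V.val φ :=
  add_nonneg (h.nonneg₁ _) (h.nonneg₂ _)

theorem IsSmoothlySeparable.continuous_val (h : V.IsSmoothlySeparable) : Continuous V.val :=
  (h.contDiff.continuous.comp Hist.continuous_now).add h.locallyLipschitz.continuous

theorem IsSmoothlySeparable.V₁_zero (h : V.IsSmoothlySeparable) : V.V₁ 0 = 0 := by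
  obtain ⟨α₁, α₂, -, h₂, hb⟩ := h.bounds
  refine le_antisymm ?_ (h.nonneg₁ 0)
  simpa [h₂.zero] using (hb 0).2

/-- The origin minimises V₁. Consequently 𝔟_i vanishes as soon as φ_i = 0, a case on which the small
control property is silent. -/
theorem IsSmoothlySeparable.fderiv_zero (h : V.IsSmoothlySeparable) :
    fderiv ℝ V.V₁ 0 = 0 := by
  refine IsLocalMin.fderiv_eq_zero (Eventually.of_forall fun y => ?_)
  rw [h.V₁_zero]
  exact h.nonneg₁ y

end SplitFunctional

/-! ### Continuity of the controller -/

namespace DelaySystem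

variable {p : ℕ} {Δ : ℝ≥0} {n m : Fin p → ℕ} {S : DelaySystem Δ n m}
  {V : ∀ i, SplitFunctional Δ (EuclideanSpace ℝ (Fin (n i)))}
  {ρ : Fin p → ℝ → ℝ} {γ : Fin p → Fin p → ℝ → ℝ}

theorem inner_coeffB (i : Fin p) (φ : Hist Δ (AugState n)) (w : EuclideanSpace ℝ (Fin (m i))) :
    inner ℝ (S.coeffB V i φ) w = S.lieG V i φ w := by
  rw [coeffB, InnerProductSpace.toDual_symm_apply]

theorem coeffB_eq_zero_iff (i : Fin p) (φ : Hist Δ (AugState n)) :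
    S.coeffB V i φ = 0 ↔ S.lieG V i φ = 0 := by
  rw [coeffB, map_eq_zero_iff _ (LinearIsometryEquiv.injective _)]

theorem rate_eq (i : Fin p) (φ : Hist Δ (AugState n)) (w : EuclideanSpace ℝ (Fin (m i))) :
    S.rate V i φ w
      = S.coeffA V ρ γ i φ + inner ℝ (S.coeffB V i φ) w + supplyRate V ρ γ i φ := by
  rw [inner_coeffB, rate, coeffA, supplyRate]
  ring

theorem coeffB_zero (i : Fin p) : S.coeffB V i 0 = 0 := by
  rw [coeffB_eq_zero_iff, lieG, S.g_zero, ContinuousLinearMap.comp_zero]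

/-- The case distinction is redundant: 𝔟_i(0) = 0 because g_i(0) = 0, and Sontag's formula takes the
value 0 at b = 0. -/
theorem controller_eq (i : Fin p) (φ : Hist Δ (AugState n)) :
    S.controller V ρ γ i φ = sontag (S.coeffA V ρ γ i φ) (S.coeffB V i φ) := by
  unfold controller
  split_ifs with h
  · rfl
  · have : S.coeffB V i φ = 0 := by
      by_contra hb
      exact h ⟨fun h0 => hb (h0 ▸ coeffB_zero i), hb⟩
    rw [this, sontag_zero_right]

theorem continuous_coeffB (hV : ∀ i, (V i).IsContIDifferentiable) (i : Fin p) :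
    Continuous (S.coeffB V i) := by
  refine (LinearIsometryEquiv.continuous _).comp ?_
  have h1 := (hV i).contDiff.continuous_fderiv one_ne_zero
  exact (h1.comp (Hist.continuous_now.comp (Hist.continuous_comp i))).clm_comp
    (S.lipschitz_g i).continuous

theorem continuous_coeffA (hV : S.IsMCLF V ρ γ) (i : Fin p) :
    Continuous (S.coeffA V ρ γ i) := by
  have hc : ∀ j, Continuous fun φ : Hist Δ (AugState n) => (V j).val (φ.comp j) := fun j =>
    (hV.iDiff j).continuous_val.comp (Hist.continuous_comp j)
  have h0 : ∀ j, ∀ φ : Hist Δ (AugState n), 0 ≤ (V j).val (φ.comp j) := fun j φ =>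
    (hV.iDiff j).val_nonneg _
  have h1 := (hV.iDiff i).contDiff.continuous_fderiv one_ne_zero
  refine Continuous.sub (Continuous.add (Continuous.add ?_ ?_) ?_) ?_
  · exact (h1.comp (Hist.continuous_now.comp (Hist.continuous_comp i))).clm_apply
      (S.lipschitz_f i).continuous
  · exact (hV.iDiff i).cont_dini.comp (Hist.continuous_comp i)
  · exact (hV.classK_ρ i).continuous_comp_nonneg (hc i) (h0 i)
  · refine continuous_finsetSum _ fun j hj => ?_
    exact (hV.classK_γ i j (Finset.ne_of_mem_erase hj)).continuous_comp_nonneg (hc j) (h0 j)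

/-- With 𝔟_i = 0 the control drops out of the rate, so the infimum in the decrease condition is 𝔞_i
plus the supply rate. -/
theorem IsMCLF.coeffA_neg (hV : S.IsMCLF V ρ γ) {i : Fin p} {φ : Hist Δ (AugState n)}
    (hφ : φ ≠ 0) (hb : S.coeffB V i φ = 0) : S.coeffA V ρ γ i φ < 0 := by
  have h := hV.decrease i φ hφ
  rw [iInf_lt_iff] at h
  obtain ⟨w, hw⟩ := h
  rw [EReal.coe_lt_coe_iff, rate_eq (ρ := ρ) (γ := γ), hb, inner_zero_left] at hw
  linarith

/-- The distributed Sontag-type controller is continuous. -/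
theorem continuous_controller (hV : S.IsMCLF V ρ γ) (hD : S.HasDSCP V ρ γ) (i : Fin p) :
    Continuous (S.controller V ρ γ i) := by
  have hfun : S.controller V ρ γ i
      = fun φ => sontag (S.coeffA V ρ γ i φ) (S.coeffB V i φ) :=
    funext fun φ => controller_eq i φ
  have hB : Continuous (S.coeffB V i) := continuous_coeffB hV.iDiff i
  rw [hfun, continuous_iff_continuousAt]
  intro φ
  rcases ne_or_eq φ 0 with hφ | rfl
  · exact ContinuousAt.comp (f := fun φ => (S.coeffA V ρ γ i φ, S.coeffB V i φ))
      (continuousAt_sontag fun hb => hV.coeffA_neg hφ hb)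
      ((continuous_coeffA hV i).prodMk hB).continuousAt
  rw [Metric.continuousAt_iff']
  intro ε hε
  simp only [coeffB_zero, sontag_zero_right, dist_zero_right]
  -- With controls below ε/4 and ‖𝔟_i‖ < ε/4, `norm_sontag_le` yields 2 · ε/4 + ε/4 < ε.
  obtain ⟨δ, hδ, h⟩ := hD (fun _ => ε / 4) (fun _ => by positivity)
  have h1 : ∀ᶠ ψ : Hist Δ (AugState n) in 𝓝 0, ‖S.coeffB V i ψ‖ < ε / 4 := by
    have := hB.norm.tendsto (0 : Hist Δ (AugState n))
    rw [coeffB_zero, norm_zero] at this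
    exact this.eventually (gt_mem_nhds (by positivity))
  have h2 : ∀ᶠ ψ : Hist Δ (AugState n) in 𝓝 0, ∀ j, ‖ψ‖ < δ j := by
    refine eventually_all.2 fun j => ?_
    have := (continuous_norm (E := Hist Δ (AugState n))).tendsto 0
    rw [norm_zero] at this
    exact this.eventually (gt_mem_nhds (hδ j))
  filter_upwards [h1, h2] with ψ hψ1 hψ2
  by_cases hi : ψ.comp i = 0
  · have : S.coeffB V i ψ = 0 := by
      rw [coeffB_eq_zero_iff, lieG, hi, Hist.zero_now, (hV.iDiff i).fderiv_zero,
        ContinuousLinearMap.zero_comp]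
    rw [this, sontag_zero_right, norm_zero]
    exact hε
  obtain ⟨w, hw, hlt⟩ := h ψ (fun j θ => mem_ball_zero_iff.2
    (((Hist.norm_eval_le _ θ).trans (Hist.norm_comp_le ψ j)).trans_lt (hψ2 j))) i hi
  rw [mem_ball_zero_iff] at hw
  rw [rate_eq (ρ := ρ) (γ := γ)] at hlt
  -- By Cauchy–Schwarz, a small admissible control w forces 𝔞_i < -⟨𝔟_i, w⟩ ≤ (ε/4)‖𝔟_i‖.
  have h3 := abs_le.1 (abs_real_inner_le_norm (S.coeffB V i ψ) w)
  have h4 : ‖S.coeffB V i ψ‖ * ‖w‖ ≤ ε / 4 * ‖S.coeffB V i ψ‖ := by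
    rw [mul_comm]; gcongr
  have h5 := norm_sontag_le (a := S.coeffA V ρ γ i ψ) (b := S.coeffB V i ψ) (ε := ε / 4)
    (by positivity) (by linarith [h3.1])
  linarith

end DelaySystem

/-! ### Comparison functions -/

/-- A pair of functions `W, Q`, positive at the same points and with `W` proper, has a continuous
`q` with `q ∘ W ≤ Q`. -/
theorem exists_continuous_minorant {X : Type*} [TopologicalSpace X] {W Q : X → ℝ}
    (hW : Continuous W) (hQ : Continuous Q) (hQ0 : ∀ x, 0 ≤ Q x) (hpos : ∀ x, 0 < W x → 0 < Q x)
    {x₀ : X} (hWx : W x₀ = 0)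
    (hQx : Q x₀ = 0) (hK : ∀ c, IsCompact {x | W x ≤ c}) :
    ∃ q : ℝ → ℝ, Continuous q ∧ (∀ s, 0 < s → 0 < q s ∧ q s ≤ s) ∧ ∀ x, q (W x) ≤ Q x := by
  have : Nonempty X := ⟨x₀⟩
  -- The minorant is q(s) = inf_x (Q(x) + |W(x) - s|). It is 1-Lipschitz as an infimum of
  -- 1-Lipschitz functions; testing at x₀ gives q(s) ≤ s, and testing at x itself gives q(W(x)) ≤
  -- Q(x).
  let F : ℝ → X → ℝ := fun s x => Q x + |W x - s|
  have hF0 : ∀ s x, 0 ≤ F s x := fun s x => add_nonneg (hQ0 x) (abs_nonneg _)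
  have hbdd : ∀ s, BddBelow (range (F s)) := fun s => ⟨0, by rintro _ ⟨x, rfl⟩; exact hF0 s x⟩
  have hle : ∀ s x, ⨅ y, F s y ≤ F s x := fun s x => ciInf_le (hbdd s) x
  refine ⟨fun s => ⨅ x, F s x, ?_, fun s hs => ⟨?_, ?_⟩, fun x => ?_⟩
  · refine LipschitzWith.continuous (K := 1) (LipschitzWith.of_le_add fun s t => ?_)
    rw [← sub_le_iff_le_add]
    refine le_ciInf fun x => ?_
    have h1 := hle s x
    have h2 : |W x - s| ≤ |W x - t| + |t - s| := abs_sub_le _ _ _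
    rw [Real.dist_eq, abs_sub_comm s t]
    simp only [F] at h1 ⊢
    linarith
  -- Positivity of q(s): on the compact shell |W - s| ≤ s/2 the term Q has a positive lower bound c,
  -- and off the shell |W - s| exceeds s/2.
  · have hC : IsCompact ({x | W x ≤ 3 * s / 2} ∩ {x | s / 2 ≤ W x}) :=
      (hK _).inter_right (isClosed_le continuous_const hW)
    obtain ⟨c, hc, hcQ⟩ : ∃ c, 0 < c ∧ ∀ x, W x ≤ 3 * s / 2 → s / 2 ≤ W x → c ≤ Q x := by
      rcases ({x | W x ≤ 3 * s / 2} ∩ {x | s / 2 ≤ W x}).eq_empty_or_nonempty with he | hne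
      · refine ⟨1, one_pos, fun x h1 h2 => ?_⟩
        have : x ∈ ({x | W x ≤ 3 * s / 2} ∩ {x | s / 2 ≤ W x}) := ⟨h1, h2⟩
        simp [he] at this
      · obtain ⟨y, hy, hmin⟩ := hC.exists_isMinOn hne hQ.continuousOn
        have hy2 : s / 2 ≤ W y := hy.2
        exact ⟨Q y, hpos y (by linarith), fun x h1 h2 => hmin ⟨h1, h2⟩⟩
    refine (lt_min hc (half_pos hs)).trans_le (le_ciInf fun x => ?_)
    by_cases h : W x ≤ 3 * s / 2 ∧ s / 2 ≤ W x
    · exact (min_le_left _ _).trans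
        ((hcQ x h.1 h.2).trans (le_add_of_nonneg_right (abs_nonneg _)))
    · refine (min_le_right _ _).trans (le_trans ?_ (le_add_of_nonneg_left (hQ0 x)))
      rw [not_and_or, not_le, not_le] at h
      rcases h with h | h
      · rw [le_abs]; left; linarith
      · rw [le_abs]; right; linarith
  · refine (hle s x₀).trans ?_
    simp [F, hWx, hQx, abs_of_pos hs]
  · refine (hle _ x).trans ?_
    simp [F]

/-- H(t) - t is nondecreasing, so H lies above t + H(0) on the right and below it on the left. -/
theorem strictMono_surjective_of_one_le_deriv {H H' : ℝ → ℝ}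
    (hH : ∀ t, HasDerivAt H (H' t) t) (h1 : ∀ t, 1 ≤ H' t) :
    StrictMono H ∧ Function.Surjective H := by
  have hc : Continuous H := continuous_iff_continuousAt.2 fun t => (hH t).continuousAt
  have hmono : Monotone fun t => H t - t := by
    refine monotone_of_hasDerivAt_nonneg (f' := fun t => H' t - 1)
      (fun t => (hH t).sub (hasDerivAt_id t)) fun t => ?_
    simpa using h1 t
  refine ⟨strictMono_of_hasDerivAt_pos hH fun t => one_pos.trans_le (h1 t),
    hc.surjective ?_ ?_⟩
  · refine tendsto_atTop_mono' _ ?_ (tendsto_atTop_add_const_right _ (H 0) tendsto_id)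
    filter_upwards [eventually_ge_atTop 0] with t ht
    have := hmono ht
    simp only [sub_zero, id] at this ⊢
    linarith
  · refine tendsto_atBot_mono' _ ?_ (tendsto_atBot_add_const_right _ (H 0) tendsto_id)
    filter_upwards [eventually_le_atBot 0] with t ht
    have := hmono ht
    simp only [sub_zero, id] at this ⊢
    linarith

/-- The flow of `ṡ = -q(s)` in the coordinate `H(log s)`. -/
noncomputable def decayFlow (H : ℝ ≃o ℝ) (s t : ℝ) : ℝ :=
  if 0 < s then Real.exp (H.symm (H (Real.log s) - t)) else 0

theorem decayFlow_of_pos (H : ℝ ≃o ℝ) {s : ℝ} (hs : 0 < s) (t : ℝ) :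
    decayFlow H s t = Real.exp (H.symm (H (Real.log s) - t)) := if_pos hs

theorem decayFlow_nonneg (H : ℝ ≃o ℝ) (s t : ℝ) : 0 ≤ decayFlow H s t := by
  unfold decayFlow; split_ifs <;> positivity

theorem decayFlow_le (H : ℝ ≃o ℝ) {s t : ℝ} (hs : 0 ≤ s) (ht : 0 ≤ t) : decayFlow H s t ≤ s := by
  rcases hs.eq_or_lt with rfl | hs
  · simp [decayFlow]
  rw [decayFlow_of_pos H hs, ← Real.le_log_iff_exp_le hs, OrderIso.symm_apply_le]
  linarith

/-- Continuity at s = 0 comes from the squeeze 0 ≤ flow ≤ s; decay in t holds because H is onto, so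
its inverse tends to -∞ at -∞. -/
theorem isClassKL_decayFlow (H : ℝ ≃o ℝ) : IsClassKL (decayFlow H) := by
  have hcont : ContinuousOn (fun q : ℝ × ℝ => decayFlow H q.1 q.2) (Ici 0 ×ˢ Ici 0) := by
    rintro ⟨s, t⟩ ⟨hs, ht⟩
    rcases (show (0 : ℝ) ≤ s from hs).eq_or_lt with rfl | hs
    · have h0 : decayFlow H 0 t = 0 := by simp [decayFlow]
      simp only [ContinuousWithinAt, h0]
      refine squeeze_zero' (g := fun q : ℝ × ℝ => q.1)
        (Eventually.of_forall fun q => decayFlow_nonneg H _ _) ?_ ?_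
      · exact eventually_nhdsWithin_of_forall fun q hq => decayFlow_le H hq.1 hq.2
      · exact (continuous_fst.tendsto ((0 : ℝ), t)).mono_left nhdsWithin_le_nhds
    · refine ContinuousAt.continuousWithinAt ?_
      have hev : ∀ᶠ q : ℝ × ℝ in 𝓝 (s, t), 0 < q.1 :=
        continuous_fst.continuousAt.eventually (lt_mem_nhds hs)
      refine ContinuousAt.congr
        (f := fun q : ℝ × ℝ => Real.exp (H.symm (H (Real.log q.1) - q.2))) ?_
        (hev.mono fun q hq => (decayFlow_of_pos H hq q.2).symm)
      have h1 := H.continuous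
      have h2 := H.symm.continuous
      have h3 : ContinuousAt (fun q : ℝ × ℝ => Real.log q.1) (s, t) :=
        continuousAt_fst.log hs.ne'
      have h4 : ContinuousAt (fun q : ℝ × ℝ => H (Real.log q.1) - q.2) (s, t) :=
        (h1.continuousAt.comp h3).sub continuousAt_snd
      exact Real.continuous_exp.continuousAt.comp (h2.continuousAt.comp h4)
  refine ⟨hcont, fun t ht => ⟨?_, ?_, by simp [decayFlow]⟩, fun s hs a _ b _ hab => ?_,
    fun s hs => ?_⟩
  · exact hcont.comp (f := fun s : ℝ => (s, t)) (by fun_prop) fun s hs => ⟨hs, ht⟩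
  · intro a ha b hb hab
    have hb0 : 0 < b := lt_of_le_of_lt ha hab
    change decayFlow H a t < decayFlow H b t
    rw [decayFlow_of_pos H hb0]
    rcases (show (0 : ℝ) ≤ a from ha).eq_or_lt with rfl | ha
    · simp only [decayFlow, lt_irrefl, if_false]
      positivity
    · rw [decayFlow_of_pos H ha, Real.exp_lt_exp, H.symm.lt_iff_lt, sub_lt_sub_iff_right,
        H.lt_iff_lt]
      exact Real.log_lt_log ha hab
  · rcases hs.eq_or_lt with rfl | hs
    · simp [decayFlow]
    · rw [decayFlow_of_pos H hs, decayFlow_of_pos H hs, Real.exp_le_exp, H.symm.le_iff_le]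
      linarith
  · rcases hs.eq_or_lt with rfl | hs
    · have h0 : decayFlow H 0 = fun _ => 0 := funext fun t => by simp [decayFlow]
      rw [h0]
      exact tendsto_const_nhds
    · rw [show decayFlow H s = _ from funext fun t => decayFlow_of_pos H hs t]
      refine Real.tendsto_exp_atBot.comp (H.symm.tendsto_atBot.comp ?_)
      exact tendsto_atBot_add_const_left _ _ tendsto_neg_atTop_atBot

theorem le_left_of_hasDerivWithinAt_right_nonpos {f f' : ℝ → ℝ} {a b : ℝ}
    (hf : ContinuousOn f (Icc a b)) (hf' : ∀ t ∈ Ico a b, HasDerivWithinAt f (f' t) (Ici t) t)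
    (h : ∀ t ∈ Ico a b, f' t ≤ 0) : ∀ t ∈ Icc a b, f t ≤ f a := fun _ ht =>
  image_le_of_deriv_right_le_deriv_boundary (B := fun _ => f a) (B' := fun _ => 0) hf hf' le_rfl
    continuousOn_const (fun _ _ => hasDerivWithinAt_const _ _ _) h ht

/-- Scalar comparison principle: for a continuous positive `q`, `q(s) ≤ s`, there is a class `𝒦ℒ`
function dominating all nonnegative functions `w` with right derivative at most `-q(w)`. -/
theorem exists_classKL_of_hasDerivWithinAt_right {q : ℝ → ℝ} (hq : Continuous q)
    (hq' : ∀ s, 0 < s → 0 < q s ∧ q s ≤ s) :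
    ∃ β, IsClassKL β ∧
      ∀ (w w' : ℝ → ℝ) (b : ℝ), 0 ≤ b → ContinuousOn w (Icc 0 b) →
        (∀ t ∈ Icc 0 b, 0 ≤ w t) →
        (∀ t ∈ Ico 0 b, HasDerivWithinAt w (w' t) (Ici t) t) →
        (∀ t ∈ Ico 0 b, w' t ≤ -q (w t)) → w b ≤ β (w 0) b := by
  have hqe : ∀ t : ℝ, 0 < q (Real.exp t) := fun t => (hq' _ (Real.exp_pos t)).1
  have hc : Continuous fun t : ℝ => Real.exp t / q (Real.exp t) :=
    Real.continuous_exp.div (hq.comp Real.continuous_exp) fun t => (hqe t).ne'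
  -- Separation of variables for ṡ = -q(s) in the coordinate log s. The condition q(s) ≤ s makes the
  -- integrand at least 1, hence H₀ a bijection of ℝ.
  let H₀ : ℝ → ℝ := fun τ => ∫ t in (0 : ℝ)..τ, Real.exp t / q (Real.exp t)
  have hH : ∀ t, HasDerivAt H₀ (Real.exp t / q (Real.exp t)) t := fun t =>
    (hc.integral_hasStrictDerivAt 0 t).hasDerivAt
  obtain ⟨hm, hs⟩ := strictMono_surjective_of_one_le_deriv hH fun t =>
    (one_le_div (hqe t)).2 (hq' _ (Real.exp_pos t)).2
  let H : ℝ ≃o ℝ := hm.orderIsoOfSurjective H₀ hs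
  refine ⟨decayFlow H, isClassKL_decayFlow H, ?_⟩
  intro w w' b hb hw hw0 hw' hle
  rcases le_or_gt (w b) 0 with hwb | hwb
  · exact hwb.trans (decayFlow_nonneg H _ _)
  -- Since w is nonincreasing, w(b) > 0 keeps w positive on all of [0, b], so its logarithm may be
  -- differentiated.
  have hpos : ∀ t ∈ Icc 0 b, 0 < w t := by
    intro t ht
    have hq0 : ∀ s, 0 ≤ s → 0 ≤ q s := by
      have : ∀ s ∈ closure (Ioi (0 : ℝ)), 0 ≤ q s :=
        fun s hs => closure_minimal (fun r hr => (hq' r hr).1.le)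
          (isClosed_le continuous_const hq) hs
      simpa [closure_Ioi] using this
    have hsub : Ico t b ⊆ Ico 0 b := Ico_subset_Ico_left ht.1
    refine hwb.trans_le (le_left_of_hasDerivWithinAt_right_nonpos
      (hw.mono (Icc_subset_Icc_left ht.1)) (fun s hs => hw' s (hsub hs)) (fun s hs => ?_) b
      (right_mem_Icc.2 ht.2))
    have := hq0 _ (hw0 s (Ico_subset_Icc_self (hsub hs)))
    linarith [hle s (hsub hs)]
  -- The right derivative of H(log w) is (w / q(w)) · (w' / w) = w' / q(w) ≤ -1.
  have hanti : H (Real.log (w b)) + b ≤ H (Real.log (w 0)) + 0 := by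
    refine le_left_of_hasDerivWithinAt_right_nonpos (f := fun t => H (Real.log (w t)) + t)
      (f' := fun t => Real.exp (Real.log (w t)) / q (Real.exp (Real.log (w t)))
        * (w' t / w t) + 1) ?_ ?_ ?_ b (right_mem_Icc.2 hb)
    · exact (H.continuous.comp_continuousOn (hw.log fun t ht => (hpos t ht).ne')).add
        continuousOn_id
    · intro t ht
      have h1 := (hw' t ht).log (hpos t (Ico_subset_Icc_self ht)).ne'
      exact ((hH _).comp_hasDerivWithinAt t h1).add (hasDerivWithinAt_id t _)
    · intro t ht
      have h0 := hpos t (Ico_subset_Icc_self ht)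
      have h1 := (hq' _ h0).1
      rw [Real.exp_log h0]
      have : w t / q (w t) * (w' t / w t) + 1 = (w' t + q (w t)) / q (w t) := by
        field_simp
      rw [this]
      exact div_nonpos_of_nonpos_of_nonneg (by linarith [hle t ht]) h1.le
  rw [decayFlow_of_pos H (hpos 0 ⟨le_rfl, hb⟩), ← Real.log_le_iff_le_exp hwb, H.le_symm_apply]
  linarith

/-! ### Operations on comparison functions and the small-gain comparison -/

theorem IsClassK.nonneg {α : ℝ → ℝ} (h : IsClassK α) {s : ℝ} (hs : 0 ≤ s) : 0 ≤ α s := by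
  simpa [h.zero] using h.strictMono.monotoneOn self_mem_Ici hs hs

theorem IsClassK.pos {α : ℝ → ℝ} (h : IsClassK α) {s : ℝ} (hs : 0 < s) : 0 < α s := by
  simpa [h.zero] using h.strictMono self_mem_Ici hs.le hs

theorem IsClassK.comp {α β : ℝ → ℝ} (h : IsClassK α) (k : IsClassK β) :
    IsClassK fun s => α (β s) where
  cont := h.cont.comp k.cont fun _ hs => k.nonneg hs
  strictMono := h.strictMono.comp k.strictMono fun _ hs => k.nonneg hs
  zero := by rw [k.zero, h.zero]

theorem IsClassKInfty.comp {α β : ℝ → ℝ} (h : IsClassKInfty α) (k : IsClassKInfty β) :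
    IsClassKInfty fun s => α (β s) where
  toIsClassK := h.toIsClassK.comp k.toIsClassK
  unbounded := h.unbounded.comp k.unbounded

theorem IsClassK.sum {ι : Type*} [Fintype ι] [Nonempty ι] {α : ι → ℝ → ℝ}
    (h : ∀ i, IsClassK (α i)) : IsClassK fun s => ∑ i, α i s where
  cont := continuousOn_finsetSum _ fun i _ => (h i).cont
  strictMono := fun _ ha _ hb hab =>
    Finset.sum_lt_sum_of_nonempty Finset.univ_nonempty fun i _ => (h i).strictMono ha hb hab
  zero := Finset.sum_eq_zero fun i _ => (h i).zero

theorem IsClassKL.sum {ι : Type*} [Fintype ι] [Nonempty ι] {β : ι → ℝ → ℝ → ℝ}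
    (h : ∀ i, IsClassKL (β i)) : IsClassKL fun s t => ∑ i, β i s t where
  cont := continuousOn_finsetSum _ fun i _ => (h i).cont
  classK := fun t ht => IsClassK.sum fun i => (h i).classK t ht
  antitone := fun s hs _ ha _ hb hab =>
    Finset.sum_le_sum fun i _ => (h i).antitone s hs ha hb hab
  tendsto := fun s hs => by
    simpa using tendsto_finsetSum Finset.univ fun i _ => (h i).tendsto s hs

theorem IsClassKL.comp {β : ℝ → ℝ → ℝ} {α κ : ℝ → ℝ} (h : IsClassKL β) (hα : IsClassK α)
    (hκ : IsClassK κ) : IsClassKL fun s t => α (β (κ s) t) := by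
  have h0 : ∀ s t, 0 ≤ s → 0 ≤ t → 0 ≤ β s t := fun s t hs ht => (h.classK t ht).nonneg hs
  refine ⟨?_, fun t ht => hα.comp ((h.classK t ht).comp hκ), fun s hs a ha b hb hab => ?_,
    fun s hs => ?_⟩
  · refine hα.cont.comp (h.cont.comp (f := fun q : ℝ × ℝ => (κ q.1, q.2)) ?_ ?_) ?_
    · exact (hκ.cont.comp continuousOn_fst fun q hq => hq.1).prodMk continuousOn_snd
    · exact fun q hq => ⟨hκ.nonneg hq.1, hq.2⟩
    · exact fun q hq => h0 _ _ (hκ.nonneg hq.1) hq.2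
  · have hk := hκ.nonneg hs
    exact hα.strictMono.monotoneOn (h0 _ _ hk hb) (h0 _ _ hk ha) (h.antitone _ hk ha hb hab)
  · have hk := hκ.nonneg hs
    have h1 : Tendsto (β (κ s)) atTop (𝓝[Ici 0] 0) :=
      tendsto_nhdsWithin_of_tendsto_nhds_of_eventually_within _ (h.tendsto _ hk)
        ((eventually_ge_atTop 0).mono fun t ht => h0 _ _ hk ht)
    have h2 := (hα.cont 0 self_mem_Ici).tendsto.comp h1
    rwa [hα.zero] at h2

/-- Extending α by the identity to the negative axis makes it an increasing bijection of ℝ, whose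
inverse is automatically continuous. -/
theorem IsClassKInfty.exists_inverse {α : ℝ → ℝ} (h : IsClassKInfty α) :
    ∃ κ, IsClassK κ ∧ ∀ a b, 0 ≤ a → α a ≤ b → a ≤ κ b := by
  let f : ℝ → ℝ := fun s => α (max s 0) + min s 0
  have hf0 : ∀ s, 0 ≤ s → f s = α s := fun s hs => by simp [f, hs]
  have hfn : ∀ s, s ≤ 0 → f s = s := fun s hs => by simp [f, hs, h.zero]
  have hc : Continuous f :=
    (h.continuous_comp_nonneg (by fun_prop) fun s => le_max_right _ _).add (by fun_prop)
  have hm : StrictMono f := by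
    intro a b hab
    have h1 : α (max a 0) ≤ α (max b 0) :=
      h.strictMono.monotoneOn (mem_Ici.2 (le_max_right _ _)) (mem_Ici.2 (le_max_right _ _))
        (max_le_max_right _ hab.le)
    have h2 : min a 0 ≤ min b 0 := min_le_min_right _ hab.le
    rcases le_or_gt 0 a with ha | ha
    · rw [hf0 a ha, hf0 b (ha.trans hab.le)]
      exact h.strictMono ha (ha.trans hab.le) hab
    · have h3 : min a 0 < min b 0 := by
        rw [min_eq_left ha.le]
        exact lt_min hab ha
      simp only [f]
      linarith
  have hs : Function.Surjective f := by
    refine hc.surjective ?_ ?_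
    · exact h.unbounded.congr' ((eventually_ge_atTop 0).mono fun s hs => (hf0 s hs).symm)
    · exact tendsto_id.congr' ((eventually_le_atBot 0).mono fun s hs => (hfn s hs).symm)
  let e : ℝ ≃o ℝ := hm.orderIsoOfSurjective f hs
  refine ⟨e.symm, ⟨e.symm.continuous.continuousOn, e.symm.strictMono.strictMonoOn _, ?_⟩,
    fun a b ha hab => ?_⟩
  · rw [OrderIso.symm_apply_eq]
    exact (hfn 0 le_rfl).symm
  · rw [OrderIso.le_symm_apply]
    exact (hf0 a ha).trans_le hab

/-- If the increasing primitive were bounded, φ would be integrable on (0, ∞), against the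
divergence of its integral. -/
theorem exists_classKInfty_primitive {φ : ℝ → ℝ} (hc : Continuous φ)
    (hpos : ∀ s, 0 < s → 0 < φ s)
    (hint : ∫⁻ s in Ioi (0 : ℝ), ENNReal.ofReal (φ s) = ∞) :
    ∃ Φ, IsClassKInfty Φ ∧ ∀ s, HasDerivAt Φ (φ s) s := by
  let Φ : ℝ → ℝ := fun r => ∫ s in (0 : ℝ)..r, φ s
  have hd : ∀ s, HasDerivAt Φ (φ s) s := fun s =>
    (hc.integral_hasStrictDerivAt 0 s).hasDerivAt
  have hcont : Continuous Φ := continuous_iff_continuousAt.2 fun s => (hd s).continuousAt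
  have hm : StrictMonoOn Φ (Ici 0) := by
    refine strictMonoOn_of_deriv_pos (convex_Ici 0) hcont.continuousOn fun s hs => ?_
    rw [interior_Ici] at hs
    rw [(hd s).deriv]
    exact hpos s hs
  refine ⟨Φ, ⟨⟨hcont.continuousOn, hm, by simp [Φ]⟩, ?_⟩, hd⟩
  by_contra hno
  obtain ⟨M, hM⟩ : ∃ M, ∀ s, 0 ≤ s → Φ s ≤ M := by
    by_contra! hM
    refine hno (tendsto_atTop.2 fun M => ?_)
    obtain ⟨s, hs, hMs⟩ := hM M
    filter_upwards [eventually_ge_atTop s] with t ht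
    exact hMs.le.trans (hm.monotoneOn hs (hs.trans ht) ht)
  have hI : MeasureTheory.IntegrableOn φ (Ioi 0) := by
    refine MeasureTheory.integrableOn_Ioi_of_intervalIntegral_norm_bounded (l := atTop)
      (b := id) M 0 (fun b => (hc.integrableOn_Icc).mono_set Ioc_subset_Icc_self) tendsto_id ?_
    filter_upwards [eventually_ge_atTop 0] with b hb
    refine le_trans (le_of_eq ?_) (hM b hb)
    refine intervalIntegral.integral_congr_ae (Eventually.of_forall fun s hs => ?_)
    rw [uIoc_of_le (show (0 : ℝ) ≤ id b from hb)] at hs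
    exact Real.norm_of_nonneg (hpos s hs.1).le
  have := hI.lintegral_lt_top
  rw [hint] at this
  exact lt_irrefl _ this

/-- The weighted sum `∑ Φ_i(v_i)` along solutions of the coupled differential inequalities
`v̇_i ≤ -ρ_i(v_i) + ∑_{j ≠ i} γ_{ij}(v_j)` is dominated by a class `𝒦ℒ` function of its initial
value. -/
theorem SmallGain.exists_classKL {p : ℕ} {ρ : Fin p → ℝ → ℝ} {γ : Fin p → Fin p → ℝ → ℝ}
    (hρ : ∀ i, IsClassK (ρ i)) (hγ : ∀ i j, j ≠ i → IsClassK (γ i j)) (h : SmallGain ρ γ) :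
    ∃ (Φ : Fin p → ℝ → ℝ) (β : ℝ → ℝ → ℝ), (∀ i, IsClassKInfty (Φ i)) ∧ IsClassKL β ∧
      ∀ (v v' : Fin p → ℝ → ℝ) (b : ℝ), 0 ≤ b → (∀ i, ContinuousOn (v i) (Icc 0 b)) →
        (∀ i, ∀ t ∈ Icc 0 b, 0 ≤ v i t) →
        (∀ i, ∀ t ∈ Ico 0 b, HasDerivWithinAt (v i) (v' i t) (Ici t) t) →
        (∀ i, ∀ t ∈ Ico 0 b,
          v' i t ≤ -ρ i (v i t) + ∑ j ∈ Finset.univ.erase i, γ i j (v j t)) →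
        ∑ i, Φ i (v i b) ≤ β (∑ i, Φ i (v i 0)) b := by
  obtain ⟨ζ, hζ, hint, hsg⟩ := h
  have hζ0 : ∀ i s, 0 ≤ ζ i s := fun i s => by
    rcases eq_or_ne s 0 with rfl | hs
    · exact (hζ i).zero.ge
    · exact ((hζ i).pos s hs).le
  -- The weights Φ_i have derivative ζ_i ∘ ρ_i on [0, ∞). The cut-off max s 0 is there because ρ_i
  -- is controlled only at nonnegative arguments.
  have hφ : ∀ i, ∃ Φ, IsClassKInfty Φ ∧ ∀ s, HasDerivAt Φ (ζ i (ρ i (max s 0))) s := by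
    intro i
    refine exists_classKInfty_primitive ((hζ i).cont.comp
      ((hρ i).continuous_comp_nonneg (by fun_prop) fun s => le_max_right _ _)) ?_ ?_
    · intro s hs
      rw [max_eq_left hs.le]
      exact (hζ i).pos _ ((hρ i).pos hs).ne'
    · rw [← hint i]
      refine MeasureTheory.setLIntegral_congr_fun measurableSet_Ioi fun s hs => ?_
      rw [max_eq_left (le_of_lt hs)]
  choose Φ hΦ hΦd using hφ
  -- Working on the closed orthant keeps every gain in its domain and makes the sublevel sets of W
  -- compact.
  let W : (Fin p → ℝ≥0) → ℝ := fun r => ∑ i, Φ i (r i)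
  let Q : (Fin p → ℝ≥0) → ℝ := fun r =>
    ∑ i, ζ i (ρ i (r i)) * (ρ i (r i) - ∑ j ∈ Finset.univ.erase i, γ i j (r j))
  have hco : ∀ i, Continuous fun r : Fin p → ℝ≥0 => (r i : ℝ) := fun i => by fun_prop
  have hW : Continuous W := continuous_finsetSum _ fun i _ =>
    (hΦ i).continuous_comp_nonneg (hco i) fun r => (r i).2
  have hQ : Continuous Q := by
    have hr : ∀ i, Continuous fun r : Fin p → ℝ≥0 => ρ i (r i) := fun i =>
      (hρ i).continuous_comp_nonneg (hco i) fun r => (r i).2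
    refine continuous_finsetSum _ fun i _ => ((hζ i).cont.comp (hr i)).mul ((hr i).sub ?_)
    exact continuous_finsetSum _ fun j hj =>
      (hγ i j (Finset.ne_of_mem_erase hj)).continuous_comp_nonneg (hco j) fun r => (r j).2
  have hQz : Q 0 = 0 := Finset.sum_eq_zero fun i _ => by
    simp [(hρ i).zero, (hζ i).zero]
  have hWz : W 0 = 0 := Finset.sum_eq_zero fun i _ => by simp [(hΦ i).zero]
  -- This is the small-gain inequality at s = A(r), which is nonzero because each ρ_i is positive
  -- off 0.
  have hQpos : ∀ r, r ≠ 0 → 0 < Q r := by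
    intro r hr
    have hs : (fun i => ρ i (r i)) ≠ 0 := by
      obtain ⟨i, hi⟩ := Function.ne_iff.1 hr
      exact Function.ne_iff.2 ⟨i, ((hρ i).pos (NNReal.coe_pos.2 (pos_iff_ne_zero.2 hi))).ne'⟩
    have := hsg _ (fun i => (r i : ℝ)) (fun i => (r i).2) (fun i => rfl) hs
    simp only [Q, mul_sub, Finset.sum_sub_distrib]
    linarith
  have hK : ∀ c, IsCompact {r | W r ≤ c} := by
    intro c
    have hR : ∀ i, ∃ R : ℝ≥0, ∀ s : ℝ≥0, Φ i s ≤ c → s ≤ R := by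
      intro i
      obtain ⟨R, hR⟩ := eventually_atTop.1 ((hΦ i).unbounded.eventually_gt_atTop c)
      refine ⟨R.toNNReal, fun s hs => ?_⟩
      by_contra hlt
      rw [not_le] at hlt
      exact absurd (hR s ((Real.le_coe_toNNReal R).trans (NNReal.coe_le_coe.2 hlt.le)))
        (not_lt.2 hs)
    choose R hR using hR
    refine (isCompact_Icc (a := (0 : Fin p → ℝ≥0)) (b := R)).of_isClosed_subset
      (isClosed_le hW continuous_const) fun r hr => ⟨zero_le, fun i => hR i _ ?_⟩
    exact (Finset.single_le_sum (f := fun i => Φ i (r i))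
      (fun j _ => (hΦ j).nonneg (r j).2) (Finset.mem_univ i)).trans hr
  obtain ⟨q, hqc, hq, hqW⟩ := exists_continuous_minorant hW hQ
    (fun r => by
      rcases eq_or_ne r 0 with rfl | hr
      · exact hQz.ge
      · exact (hQpos r hr).le)
    (fun r hr => hQpos r (by rintro rfl; exact hr.ne' hWz)) hWz hQz hK
  obtain ⟨β, hβ, hcmp⟩ := exists_classKL_of_hasDerivWithinAt_right hqc hq
  refine ⟨Φ, β, hΦ, hβ, fun v v' b hb hv hv0 hd hle => ?_⟩
  refine hcmp (fun t => ∑ i, Φ i (v i t)) (fun t => ∑ i, ζ i (ρ i (max (v i t) 0)) * v' i t) b hb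
    (continuousOn_finsetSum _ fun i _ => (hΦ i).cont.comp (hv i) (hv0 i))
    (fun t ht => Finset.sum_nonneg fun i _ => (hΦ i).nonneg (hv0 i t ht))
    (fun t ht => HasDerivWithinAt.fun_sum fun i _ =>
      (hΦd i _).comp_hasDerivWithinAt t (hd i t ht)) fun t ht => ?_
  have h0 : ∀ i, 0 ≤ v i t := fun i => hv0 i t (Ico_subset_Icc_self ht)
  have h1 : q (∑ i, Φ i (v i t)) ≤ ∑ i, ζ i (ρ i (v i t)) *
      (ρ i (v i t) - ∑ j ∈ Finset.univ.erase i, γ i j (v j t)) := hqW fun i => ⟨v i t, h0 i⟩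
  rw [le_neg, ← Finset.sum_neg_distrib]
  refine h1.trans (Finset.sum_le_sum fun i _ => ?_)
  rw [max_eq_left (h0 i), ← mul_neg]
  refine mul_le_mul_of_nonneg_left ?_ (hζ0 _ _)
  linarith [hle i t ht]

/-! ### Functionals along trajectories -/

theorem timeInterval_of_le {T : EReal} {s t : ℝ} (ht : t ∈ timeInterval T) (hs : 0 ≤ s)
    (hst : s ≤ t) : s ∈ timeInterval T :=
  ⟨hs, (EReal.coe_le_coe_iff.2 hst).trans_lt ht.2⟩

/-- Differentiability of the V_i is assumed along trajectories defined for all time. Freezing a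
solution at a time b < T produces one, with unchanged histories up to b. -/
theorem IsTrajectory.comp_min {Δ : ℝ≥0} {E : Type*} [TopologicalSpace E] {x : ℝ → E}
    {T : EReal} (hx : IsTrajectory Δ x T) {b : ℝ} (hb : b ∈ timeInterval T) :
    IsTrajectory Δ (fun τ => x (min τ b)) ⊤ := by
  refine ⟨?_, hx.cont.comp (by fun_prop) fun τ hτ =>
    timeInterval_of_le hb (le_min hτ.1 hb.1) (min_le_right _ _)⟩
  have : (fun θ : DelayInterval Δ => x (min (θ : ℝ) b)) = fun θ : DelayInterval Δ => x θ :=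
    funext fun θ => by rw [min_eq_left (θ.2.2.trans hb.1)]
  rw [this]
  exact hx.init

section Trajectories

variable {Δ : ℝ≥0} {E : Type*} [NormedAddCommGroup E] [NormedSpace ℝ E]

theorem seg_congr {x y : ℝ → E} {s t : ℝ}
    (h : ∀ θ : DelayInterval Δ, x (s + θ) = y (t + θ)) : seg Δ x s = seg Δ y t := by
  have : (fun θ : DelayInterval Δ => x (s + θ)) = fun θ : DelayInterval Δ => y (t + θ) :=
    funext h
  unfold seg
  split_ifs with h1 h2 h2
  · exact Hist.ext_eval h
  · exact absurd (this ▸ h1) h2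
  · exact absurd (this ▸ h2) h1
  · rfl

theorem IsTrajectory.now_seg {x : ℝ → E} {T : EReal} (hx : IsTrajectory Δ x T) {t : ℝ}
    (ht : t ∈ timeInterval T) : (seg Δ x t).now = x t := by
  rw [Hist.now, eval_seg hx ht]
  simp [DelayInterval.zero]

theorem seg_comp_min (x : ℝ → E) {b t : ℝ} (h : t ≤ b) :
    seg Δ (fun τ => x (min τ b)) t = seg Δ x t :=
  seg_congr fun θ => by rw [min_eq_left (by linarith [θ.2.2])]

namespace SplitFunctional

variable {V : SplitFunctional Δ E}

theorem IsContIDifferentiable.continuousOn_val_seg (hV : V.IsContIDifferentiable) {x : ℝ → E}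
    {T : EReal} (hx : IsTrajectory Δ x T) {b : ℝ} (hb : b ∈ timeInterval T) :
    ContinuousOn (fun t => V.val (seg Δ x t)) (Icc 0 b) := by
  have h1 : ContinuousOn (fun t => V.V₁ (x t)) (Icc 0 b) :=
    hV.contDiff.continuous.comp_continuousOn
      (hx.cont.mono fun t ht => timeInterval_of_le hb ht.1 ht.2)
  have h2 : ContinuousOn (fun t => V.V₂ (seg Δ (fun τ => x (min τ b)) t)) (Icc 0 b) :=
    (hV.cont_along _ (hx.comp_min hb)).mono Icc_subset_Ici_self
  refine (h1.add h2).congr fun t ht => ?_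
  simp only [val, hx.now_seg (timeInterval_of_le hb ht.1 ht.2), Pi.add_apply, seg_comp_min x ht.2]

/-- Since x has a right derivative, the increment z is O(l), so the remainder o(√(|z|² + l²)) is
o(l); replacing z by l·d inside the derivative of V₁ costs another o(l). -/
theorem IsContIDifferentiable.hasDerivWithinAt_val_seg_of_top (hV : V.IsContIDifferentiable)
    {x : ℝ → E} (hx : IsTrajectory Δ x ⊤) {t : ℝ} (ht : 0 ≤ t) {d : E}
    (hd : HasDerivWithinAt x d (Ici t) t) :
    HasDerivWithinAt (fun τ => V.val (seg Δ x τ))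
      (fderiv ℝ V.V₁ (x t) d + diniAt V.V₂ (seg Δ x t)) (Ici t) t := by
  rw [← hasDerivWithinAt_Ioi_iff_Ici, hasDerivWithinAt_iff_isLittleO] at hd ⊢
  have hshift : Tendsto (fun τ => τ - t) (𝓝[>] t) (𝓝[>] 0) := by
    refine tendsto_nhdsWithin_of_tendsto_nhds_of_eventually_within _ ?_
      (eventually_nhdsWithin_of_forall fun τ hτ => mem_Ioi.2 (sub_pos.2 hτ))
    have : Tendsto (fun τ => τ - t) (𝓝 t) (𝓝 (t - t)) := by
      exact (continuous_id.sub continuous_const).tendsto t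
    rw [sub_self] at this
    exact this.mono_left nhdsWithin_le_nhds
  have hE := (hV.expansion x hx t ht).comp_tendsto hshift
  simp only [Function.comp_def, add_sub_cancel] at hE
  have hz : (fun τ => x τ - x t) =O[𝓝[>] t] fun τ => τ - t := by
    have h1 : (fun τ => (τ - t) • d) =O[𝓝[>] t] fun τ => τ - t :=
      Asymptotics.IsBigO.of_bound ‖d‖ (Eventually.of_forall fun τ => by
        rw [norm_smul, mul_comm])
    simpa using hd.isBigO.add h1
  have hsq : (fun τ => √(‖x τ - x t‖ ^ 2 + (τ - t) ^ 2)) =O[𝓝[>] t] fun τ => τ - t := by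
    refine Asymptotics.IsBigO.trans (Asymptotics.IsBigO.of_bound 1
      (Eventually.of_forall fun τ => ?_))
      (hz.norm_left.add (Asymptotics.isBigO_refl (fun τ => τ - t) _).norm_left)
    rw [one_mul, Real.norm_of_nonneg (Real.sqrt_nonneg _), Real.norm_of_nonneg (by positivity)]
    refine Real.sqrt_le_iff.2 ⟨by positivity, ?_⟩
    have h1 := mul_nonneg (norm_nonneg (x τ - x t)) (norm_nonneg (τ - t))
    have h2 : ‖τ - t‖ ^ 2 = (τ - t) ^ 2 := by rw [Real.norm_eq_abs, sq_abs]
    nlinarith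
  have hA : (fun τ => fderiv ℝ V.V₁ (x t) (x τ - x t - (τ - t) • d)) =o[𝓝[>] t]
      fun τ => τ - t :=
    ((fderiv ℝ V.V₁ (x t)).isBigO_comp _ _).trans_isLittleO hd
  refine ((hE.trans_isBigO hsq).add hA).congr_left fun τ => ?_
  simp only [map_sub, map_smul, smul_eq_mul]
  ring

theorem IsContIDifferentiable.hasDerivWithinAt_val_seg (hV : V.IsContIDifferentiable)
    {x : ℝ → E} {T : EReal} (hx : IsTrajectory Δ x T) {t : ℝ} (ht : t ∈ timeInterval T) {d : E}
    (hd : HasDerivWithinAt x d (Ici t) t) :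
    HasDerivWithinAt (fun τ => V.val (seg Δ x τ))
      (fderiv ℝ V.V₁ (x t) d + diniAt V.V₂ (seg Δ x t)) (Ici t) t := by
  -- Taking b strictly after t leaves a right neighbourhood of t untouched by the freezing.
  obtain ⟨b, htb, hbT⟩ := EReal.lt_iff_exists_real_btwn.1 ht.2
  rw [EReal.coe_lt_coe_iff] at htb
  have hb : b ∈ timeInterval T := ⟨ht.1.trans htb.le, hbT⟩
  have hev : ∀ᶠ τ in 𝓝[≥] t, τ ≤ b :=
    mem_nhdsWithin_of_mem_nhds (Iic_mem_nhds htb)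
  have hd' : HasDerivWithinAt (fun τ => x (min τ b)) d (Ici t) t :=
    hd.congr_of_eventuallyEq (hev.mono fun τ hτ => by simp only [min_eq_left hτ])
      (by simp only [min_eq_left htb.le])
  have h := hV.hasDerivWithinAt_val_seg_of_top (hx.comp_min hb) ht.1 hd'
  rw [seg_comp_min x htb.le, min_eq_left htb.le] at h
  exact h.congr_of_eventuallyEq (hev.mono fun τ hτ => by simp only [seg_comp_min x hτ])
    (by simp only [seg_comp_min x htb.le])

end SplitFunctional

theorem seg_zero (t : ℝ) : seg Δ (fun _ => (0 : E)) t = 0 := by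
  unfold seg
  split_ifs <;> rfl

/-- Needed at φ = 0, which the decrease condition excludes: the constant continuation of the zero
history has only zero histories. -/
theorem diniAt_zero (h : Hist Δ E → ℝ) : diniAt h 0 = 0 := by
  have hf : freeze (0 : Hist Δ E) = fun _ => 0 := by
    funext t
    unfold freeze
    split_ifs <;> rfl
  simp [diniAt, upperDini, hf, seg_zero]

end Trajectories

section Components

variable {p : ℕ} {Δ : ℝ≥0} {n : Fin p → ℕ}

theorem AugState.norm_le_sum (y : AugState n) : ‖y‖ ≤ ∑ i, ‖y i‖ := by
  rw [PiLp.norm_eq_of_L2]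
  exact Real.sqrt_le_iff.2 ⟨Finset.sum_nonneg fun i _ => norm_nonneg _,
    Finset.sum_sq_le_sq_sum_of_nonneg fun i _ => norm_nonneg _⟩

theorem IsTrajectory.component {x : ℝ → AugState n} {T : EReal} (hx : IsTrajectory Δ x T)
    (i : Fin p) : IsTrajectory Δ (fun t => x t i) T :=
  ⟨((Hist.mk _ hx.init).comp i).isPC,
    (by fun_prop : Continuous fun y : AugState n => y i).comp_continuousOn hx.cont⟩

theorem IsTrajectory.seg_component {x : ℝ → AugState n} {T : EReal} (hx : IsTrajectory Δ x T)
    (i : Fin p) {t : ℝ} (ht : t ∈ timeInterval T) :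
    (seg Δ x t).comp i = seg Δ (fun t => x t i) t :=
  Hist.ext_eval fun θ => by
    rw [Hist.comp_eval, eval_seg hx ht, eval_seg (hx.component i) ht]

end Components

/-! ### Dissipation and stability of the closed loop -/

namespace DelaySystem

variable {p : ℕ} {Δ : ℝ≥0} {n m : Fin p → ℕ} {S : DelaySystem Δ n m}
  {V : ∀ i, SplitFunctional Δ (EuclideanSpace ℝ (Fin (n i)))}
  {ρ : Fin p → ℝ → ℝ} {γ : Fin p → Fin p → ℝ → ℝ}

theorem IsMCLF.val_zero (hV : S.IsMCLF V ρ γ) (i : Fin p) : (V i).val 0 = 0 := by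
  obtain ⟨α₁, α₂, -, h₂, h⟩ := hV.bounds i
  refine le_antisymm ?_ ((hV.iDiff i).val_nonneg 0)
  simpa [h₂.zero] using (h 0).2

/-- Sontag's feedback enforces the dissipation inequality. -/
theorem IsMCLF.rate_controller_le (hV : S.IsMCLF V ρ γ) (i : Fin p) (φ : Hist Δ (AugState n)) :
    S.rate V i φ (S.controller V ρ γ i φ) ≤ supplyRate V ρ γ i φ := by
  rcases eq_or_ne φ 0 with rfl | hφ
  -- At φ = 0 both sides vanish.
  · have h1 : supplyRate V ρ γ i (0 : Hist Δ (AugState n)) = 0 := by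
      simp only [supplyRate, Hist.zero_comp, hV.val_zero, (hV.classK_ρ i).zero, neg_zero, zero_add]
      exact Finset.sum_eq_zero fun j hj => (hV.classK_γ i j (Finset.ne_of_mem_erase hj)).zero
    rw [h1, rate, lieF, lieG, S.f_zero, S.g_zero, Hist.zero_comp, diniAt_zero]
    simp
  rw [rate_eq (ρ := ρ) (γ := γ), controller_eq]
  by_cases hb : S.coeffB V i φ = 0
  · rw [hb, inner_zero_left]
    linarith [hV.coeffA_neg hφ hb]
  · rw [inner_sontag _ hb]
    linarith [Real.sqrt_nonneg (S.coeffA V ρ γ i φ ^ 2 + ‖S.coeffB V i φ‖ ^ 4)]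

/-- The closed loop under Sontag's feedback is globally asymptotically stable. -/
theorem isGAS_controller (hp : 0 < p) (hV : S.IsMCLF V ρ γ) :
    S.IsGAS (S.controller V ρ γ) := by
  have : Nonempty (Fin p) := ⟨⟨0, hp⟩⟩
  obtain ⟨Φ, β, hΦ, hβ, hcmp⟩ := hV.smallGain.exists_classKL hV.classK_ρ hV.classK_γ
  choose α₁ α₂ hα₁ hα₂ hα using hV.bounds
  -- κ_i undoes Φ_i ∘ α₁ and recovers |x_i| from the weighted sum, while ∑ Φ_i ∘ α₂ bounds the
  -- initial sum by ‖ξ‖. The final bound is ∑ κ_i(β(∑ Φ_j(α₂(‖ξ‖)), t)).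
  choose κ hκ hκ' using fun i => ((hΦ i).comp (hα₁ i)).exists_inverse
  have hη : IsClassK fun s => ∑ i, Φ i (α₂ i s) :=
    IsClassK.sum fun i => (hΦ i).toIsClassK.comp (hα₂ i).toIsClassK
  refine ⟨_, IsClassKL.sum fun i => hβ.comp (hκ i) hη, fun ξ T x hx b hb => ?_⟩
  have hin : ∀ t ∈ Icc 0 b, t ∈ timeInterval T := fun t ht => timeInterval_of_le hb ht.1 ht.2
  have hcomp := hcmp (fun i t => (V i).val (seg Δ (fun τ => x τ i) t))
    (fun i t => S.rate V i (seg Δ x t) (S.controller V ρ γ i (seg Δ x t))) b hb.1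
    (fun i => (hV.iDiff i).continuousOn_val_seg (hx.traj.component i) hb)
    (fun i t _ => (hV.iDiff i).val_nonneg _) ?_ ?_
  · have h0 : ∑ i, Φ i ((V i).val (seg Δ (fun τ => x τ i) 0)) ≤ ∑ i, Φ i (α₂ i ‖ξ‖) := by
      have hseg : seg Δ x 0 = ξ := Hist.ext_eval fun θ => by
        rw [eval_seg hx.traj (hin 0 ⟨le_rfl, hb.1⟩), zero_add, hx.init]
      refine Finset.sum_le_sum fun i _ => (hΦ i).strictMono.monotoneOn
        ((hV.iDiff i).val_nonneg _) ((hα₂ i).nonneg (norm_nonneg _)) ?_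
      rw [← hx.traj.seg_component i (hin 0 ⟨le_rfl, hb.1⟩), hseg]
      exact (hα i _).2.trans ((hα₂ i).strictMono.monotoneOn (norm_nonneg _) (norm_nonneg _)
        (Hist.norm_comp_le ξ i))
    -- |x| is at most the sum of the |x_i|, and each Φ_i(α₁(|x_i|)) is bounded by the whole weighted
    -- sum.
    refine (AugState.norm_le_sum _).trans (Finset.sum_le_sum fun i _ =>
      hκ' i _ _ (norm_nonneg _) ?_)
    have hΦ0 : ∀ j, 0 ≤ Φ j ((V j).val (seg Δ (fun τ => x τ j) b)) := fun j =>
      (hΦ j).nonneg ((hV.iDiff j).val_nonneg _)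
    calc Φ i (α₁ i ‖x b i‖) ≤ Φ i ((V i).val (seg Δ (fun τ => x τ i) b)) := by
          refine (hΦ i).strictMono.monotoneOn ((hα₁ i).nonneg (norm_nonneg _))
            ((hV.iDiff i).val_nonneg _) ?_
          have := (hα i (seg Δ (fun τ => x τ i) b)).1
          rwa [(hx.traj.component i).now_seg hb] at this
      _ ≤ ∑ j, Φ j ((V j).val (seg Δ (fun τ => x τ j) b)) :=
          Finset.single_le_sum (fun j _ => hΦ0 j) (Finset.mem_univ i)
      _ ≤ β (∑ j, Φ j ((V j).val (seg Δ (fun τ => x τ j) 0))) b := hcomp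
      _ ≤ β (∑ j, Φ j (α₂ j ‖ξ‖)) b :=
          (hβ.classK b hb.1).strictMono.monotoneOn
            (Finset.sum_nonneg fun j _ => (hΦ j).nonneg ((hV.iDiff j).val_nonneg _))
            (hη.nonneg (norm_nonneg _)) h0
  · intro i t ht
    have htT := hin t (Ico_subset_Icc_self ht)
    have h := (hV.iDiff i).hasDerivWithinAt_val_seg (hx.traj.component i) htT (hx.ode i t htT)
    convert h using 1
    rw [rate, lieF, lieG, hx.traj.seg_component i htT, (hx.traj.component i).now_seg htT,
      map_add, ContinuousLinearMap.comp_apply]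
    ring
  · intro i t ht
    have htT := hin t (Ico_subset_Icc_self ht)
    have h := hV.rate_controller_le i (seg Δ x t)
    simpa only [supplyRate, hx.traj.seg_component _ htT] using h

end DelaySystem

theorem theorem1 {p : ℕ} (hp : 0 < p) (Δ : ℝ≥0) (hΔ : 0 < Δ) (n m : Fin p → ℕ)
    (S : DelaySystem Δ n m)
    (V : ∀ i, SplitFunctional Δ (EuclideanSpace ℝ (Fin (n i))))
    (ρ : Fin p → ℝ → ℝ) (γ : Fin p → Fin p → ℝ → ℝ)
    (hV : S.IsMCLF V ρ γ) (hD : S.HasDSCP V ρ γ) :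
    (∀ i, Continuous (S.controller V ρ γ i)) ∧ S.IsGAS (S.controller V ρ γ) := by
  exact ⟨DelaySystem.continuous_controller hV hD, DelaySystem.isGAS_controller hp hV⟩
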